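/- Let $N\ge 1$ and let $M$ be an $N\times N$ complex Ginibre random matrix, i.e. a random variable with values in $M_N(\mathbb C)$ such that the real and imaginary parts of all entries are independent real Gaussian variables of law $\mathcal N(0,1/2)$. Let $dz_1\cdots dz_N$ be Lebesgue measure on $\mathbb C^N\simeq\mathbb R^{2N}$, and put $$\gamma(z)=\pi^{-1}e^{-|z|^2},\qquad K_N(z,w)=\sqrt{\gamma(z)\gamma(w)}\sum_{l=0}^{N-1}\frac{(z\overline w)^l}{l!}\qquad(z,w\in\mathbb C).$$ 1. The spectrum of $M$, viewed as an exchangeable random vector $(\lambda_1,\dots,\lambda_N)$ of $\mathbb C^N$ (the eigenvalues, counted with algebraic multiplicity, put in a uniformly random order; this law is well defined, and every exchangeable random vector listing the eigenvalues of $M$ has it), has a density with respect to Lebesgue measure on $\mathbb C^N$, equal to $$\phi_N(z_1,\dots,z_N)=\frac{\prod_{k=1}^N\gamma(z_k)}{\prod_{k=1}^N k!}\prod_{i<j}|z_i-z_j|^2=\frac1{N!}\det[K_N(z_i,z_j)]_{1\le i,j\le N}.$$ 2. The set of eigenvalues of $M$ is a determinantal point process in $\mathbb C$ with kernel $K_N$.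 Here a point process is a random locally finite subset $Z$ of $\mathbb C$, measurable for the σ-algebra generated by the maps $Z\mapsto|Z\cap A|$ with $A$ compact; measurable functions $\psi_k:\mathbb C^k\to[0,\infty)$, $k\ge1$, are correlation functions of $Z$ if $$\mathbb E\big(|Z\cap B_1|\cdots|Z\cap B_k|\big)=\int_{B_1\times\cdots\times B_k}\psi_k(z_1,\dots,z_k)\,dz_1\cdots dz_k$$ for all $k\ge1$ and all pairwise disjoint compact $B_1,\dots,B_k\subset\mathbb C$; and $Z$ is determinantal with kernel $K$ if it has correlation functions with $\psi_k(z_1,\dots,z_k)=\det[K(z_i,z_j)]_{1\le i,j\le k}$ for almost all $(z_1,\dots,z_k)\in\mathbb C^k$, for every $k\ge 1$. 3. For $1\le k\le N$ and all $(z_1,\dots,z_k)\in\mathbb C^k$ the integral $$\phi_{N,k}(z_1,\dots,z_k)=\int_{\mathbb C^{N-k}}\phi_N(z_1,\dots,z_N)\,dz_{k+1}\cdots dz_N$$ converges, $\phi_{N,k}$ is the density of $(\lambda_1,\dots,\lambda_k)$, and $$\phi_{N,k}(z_1,\dots,z_k)=\frac{(N-k)!}{N!}\det[K_N(z_i,z_j)]_{1\le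 i,j\le k}\quad\text{for all }(z_1,\dots,z_k)\in\mathbb C^k.$$ If $(\psi_k)_{k\ge1}$ are any correlation functions of the point process of eigenvalues of $M$, then $\phi_{N,k}=\frac{(N-k)!}{N!}\psi_k$ almost everywhere. In particular $\phi_{N,N}=\phi_N$ and, for all $z\in\mathbb C$, $$\phi_{N,1}(z)=\frac{\gamma(z)}{N}\sum_{l=0}^{N-1}\frac{|z|^{2l}}{l!}.$$ -/

import Mathlib

open MeasureTheory ProbabilityTheory
open scoped ENNReal NNReal Nat ComplexConjugate

noncomputable section

/-! ### The Ginibre ensemble -/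

/-- The real coordinates of the entries of a complex matrix: `((i, j), true)` is the real part of
the entry `(i, j)` and `((i, j), false)` is its imaginary part. -/
def realCoordinate {N : ℕ} (p : (Fin N × Fin N) × Bool) (A : Matrix (Fin N) (Fin N) ℂ) : ℝ :=
  if p.2 then (A p.1.1 p.1.2).re else (A p.1.1 p.1.2).im

/-- `M` is an `N × N` complex Ginibre random matrix on `(Ω, P)`: it is a random variable, and the
real and imaginary parts of all its entries are independent centred real Gaussian variables of
variance `1/2`. -/
structure IsComplexGinibre {Ω : Type*} [MeasurableSpace Ω] (P : Measure Ω) {N : ℕ}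
    (M : Ω → Matrix (Fin N) (Fin N) ℂ) : Prop where
  measurable_entry : ∀ i j, Measurable fun ω => M ω i j
  law : ∀ p, P.map (fun ω => realCoordinate p (M ω)) = gaussianReal 0 (1 / 2)
  indep : iIndepFun (fun p ω => realCoordinate p (M ω)) P

/-! ### The spectrum as an exchangeable vector -/

/-- `v` lists the eigenvalues of `A`, with algebraic multiplicity, in some order. -/
def IsEigenvalueList {N : ℕ} (A : Matrix (Fin N) (Fin N) ℂ) (v : Fin N → ℂ) : Prop :=
  Finset.univ.val.map v = A.charpoly.roots

theorem exists_isEigenvalueList {N : ℕ} (A : Matrix (Fin N) (Fin N) ℂ) :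
    ∃ v : Fin N → ℂ, IsEigenvalueList A v := by
  have hc : A.charpoly.roots.card = N := by
    rw [← (IsAlgClosed.splits A.charpoly).natDegree_eq_card_roots,
      Matrix.charpoly_natDegree_eq_dim, Fintype.card_fin]
  have hl : A.charpoly.roots.toList.length = N := by rw [Multiset.length_toList, hc]
  refine ⟨fun i => A.charpoly.roots.toList.get (Fin.cast hl.symm i), ?_⟩
  have h : List.ofFn (fun i : Fin N => A.charpoly.roots.toList.get (Fin.cast hl.symm i))
      = A.charpoly.roots.toList := by
    apply List.ext_get
    · simp [hc]
    · intro n h1 h2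
      simp
  unfold IsEigenvalueList
  rw [Fin.univ_val_map, h, Multiset.coe_toList]

/-- Some list of the eigenvalues of `A`. -/
def someEigenvalueList {N : ℕ} (A : Matrix (Fin N) (Fin N) ℂ) : Fin N → ℂ :=
  (exists_isEigenvalueList A).choose

/-- The law of the vector of eigenvalues of the deterministic matrix `A` put in uniformly random
order; it does not depend on the list of eigenvalues one starts from. -/
def uniformlyOrderedEigenvalues {N : ℕ} (A : Matrix (Fin N) (Fin N) ℂ) : Measure (Fin N → ℂ) :=
  ((N ! : ℝ≥0∞))⁻¹ • ∑ σ : Equiv.Perm (Fin N), Measure.dirac (someEigenvalueList A ∘ σ)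

/-- The law on `ℂ^N` of the spectrum of the random matrix `M`, seen as an exchangeable vector:
the eigenvalues of `M` put in uniformly random order, independent of `M`. -/
def spectrumLaw {Ω : Type*} [MeasurableSpace Ω] (P : Measure Ω) {N : ℕ}
    (M : Ω → Matrix (Fin N) (Fin N) ℂ) : Measure (Fin N → ℂ) :=
  P.bind fun ω => uniformlyOrderedEigenvalues (M ω)

/-- `Λ` is an exchangeable vector of the eigenvalues of the random matrix `M`. -/
structure IsExchangeableEigenvalueVector {Ω : Type*} [MeasurableSpace Ω] (P : Measure Ω) {N : ℕ}
    (M : Ω → Matrix (Fin N) (Fin N) ℂ) (Λ : Ω → Fin N → ℂ) : Prop where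
  aemeasurable : AEMeasurable Λ P
  eigenvalues : ∀ᵐ ω ∂P, IsEigenvalueList (M ω) (Λ ω)
  exchangeable : ∀ σ : Equiv.Perm (Fin N), P.map (fun ω => Λ ω ∘ σ) = P.map Λ

/-! ### Point processes in the complex plane -/

/-- Locally finite subsets of `ℂ`. -/
def LocallyFiniteSubset : Type :=
  {Z : Set ℂ // ∀ K : Set ℂ, IsCompact K → (Z ∩ K).Finite}

/-- `|Z ∩ A|`. -/
def LocallyFiniteSubset.count (A : Set ℂ) (Z : LocallyFiniteSubset) : ℕ := (Z.1 ∩ A).ncard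

/-- The smallest σ-algebra that makes `Z ↦ |Z ∩ A|` measurable for every compact `A`. -/
instance : MeasurableSpace LocallyFiniteSubset :=
  ⨆ A : {A : Set ℂ // IsCompact A}, MeasurableSpace.comap (LocallyFiniteSubset.count A.1) ⊤

/-- `(ψ k)`, `k ≥ 1`, are correlation functions of the point process `Z`. -/
def HasCorrelationFunctions {Ω : Type*} [MeasurableSpace Ω] (P : Measure Ω)
    (Z : Ω → LocallyFiniteSubset) (ψ : (k : ℕ) → (Fin k → ℂ) → ℝ≥0) : Prop :=
  ∀ k : ℕ, 1 ≤ k → AEMeasurable (ψ k) volume ∧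
    ∀ B : Fin k → Set ℂ, (∀ i, IsCompact (B i)) → Pairwise (fun i j => Disjoint (B i) (B j)) →
      ∫⁻ ω, ∏ i, ((Z ω).count (B i) : ℝ≥0∞) ∂P = ∫⁻ z in Set.univ.pi B, (ψ k z : ℝ≥0∞)

/-- The determinant `det [K(z_i, z_j)]` over `i, j ≤ k`. -/
def kernelDet (K : ℂ → ℂ → ℂ) {k : ℕ} (z : Fin k → ℂ) : ℂ :=
  (Matrix.of fun i j => K (z i) (z j)).det

/-- `Z` is a determinantal point process of kernel `K`. -/
def IsDeterminantalPointProcess {Ω : Type*} [MeasurableSpace Ω] (P : Measure Ω)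
    (Z : Ω → LocallyFiniteSubset) (K : ℂ → ℂ → ℂ) : Prop :=
  Measurable Z ∧ ∃ ψ : (k : ℕ) → (Fin k → ℂ) → ℝ≥0, HasCorrelationFunctions P Z ψ ∧
    ∀ k : ℕ, 1 ≤ k → ∀ᵐ z : Fin k → ℂ, ((ψ k z : ℝ) : ℂ) = kernelDet K z

/-- The set of eigenvalues of a matrix. -/
def eigenvalueSet {N : ℕ} (A : Matrix (Fin N) (Fin N) ℂ) : LocallyFiniteSubset :=
  ⟨spectrum ℂ A, fun _ _ => (Matrix.finite_spectrum A).inter_of_left _⟩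

/-! ### The explicit densities -/

/-- `γ(z) = π⁻¹ exp(-|z|²)`. -/
def ginibreWeight (z : ℂ) : ℝ := Real.pi⁻¹ * Real.exp (-‖z‖ ^ 2)

/-- `φ_N(z) = ∏ γ(z_k) / ∏ k! · ∏_{i<j} |z_i - z_j|²`. -/
def ginibreDensity (N : ℕ) (z : Fin N → ℂ) : ℝ :=
  (∏ k, ginibreWeight (z k)) / (∏ k ∈ Finset.Icc 1 N, (k ! : ℝ)) *
    ∏ i, ∏ j ∈ Finset.Ioi i, ‖z i - z j‖ ^ 2

/-- `K_N(z, w) = √(γ(z)γ(w)) ∑_{l<N} (z w̄)^l / l!`. -/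
def ginibreKernel (N : ℕ) (z w : ℂ) : ℂ :=
  (Real.sqrt (ginibreWeight z * ginibreWeight w) : ℂ) *
    ∑ l ∈ Finset.range N, (z * conj w) ^ l / (l ! : ℂ)

/-- The point `(z_1, …, z_k, w_1, …, w_{N-k})` of `ℂ^N`. -/
def joinPoints {k N : ℕ} (h : k ≤ N) (z : Fin k → ℂ) (w : Fin (N - k) → ℂ) : Fin N → ℂ :=
  fun i => Fin.append z w (Fin.cast (Nat.add_sub_of_le h).symm i)

/-- `φ_{N,k}(z_1, …, z_k)`, the integral of `φ_N` over its last `N - k` variables. -/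
def ginibreMarginal {k N : ℕ} (h : k ≤ N) (z : Fin k → ℂ) : ℝ :=
  ∫ w : Fin (N - k) → ℂ, ginibreDensity N (joinPoints h z w)

end

/-! ### Eigenvalue lists and measurability -/

/-! The eigenvalue density is found by induction on the dimension, without the Schur decomposition
of the whole matrix. Fix the last `n` rows `Y` of a square matrix of size `n + 1` and describe the
first row by an eigenvalue `l` and a left eigenvector `(1, v)`. The complex Jacobian of this change
of variables is `χ'(l)`, where `χ` is the characteristic polynomial, so the real one is `|χ'(l)|²`
(`hasFDerivAt_eigenRow_real`). Each matrix generically has `n + 1` such descriptions; keeping only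
the lexicographically largest eigenvalue makes the map a bijection for almost every `Y`
(`injOn_eigenRow`, `image_eigenRow`, `ae_noSingularEigenvector`).

Now integrate over `Y` with `l` and `v` fixed. The integrand is invariant under unitary conjugation,
so a unitary matrix whose first row is proportional to `(1, v)` reduces the integral to matrices
with first row `(l, 0, …, 0)`, at the price of a factor depending on `v` only
(`exists_lintegral_eigenRows`). There the remaining eigenvalues are those of an `n × n` Gaussian
block, and `|χ'(l)|²` is the product of the `|l - z_i|²`: exactly the factor that turns the density
of size `n` into that of size `n + 1` (`hasGinibreEigenvalueLaw_succ`). Constants are not computed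
along the way. They are fixed at the end by total mass.

The mass and the marginals come from the kernel. `K_N` is the kernel of the orthogonal projection
onto the span of `N` orthonormal modes, hence it reproduces itself and has trace `N`. Expanding a
bordered determinant then shows that integrating out one point of a `(k + 1)`-point determinant
gives `N - k` times the `k`-point one (`integral_kernelDet_snoc`). The Vandermonde determinant
identifies the density with the `N`-point determinant divided by `N!`
(`ginibreDensity_eq_kernelDetReal`).

Only symmetric functions of the eigenvalues are ever integrated, so no measurable ordering is
needed; general functions are reached by averaging over permutations. For the point process, a
product of counts over disjoint sets is a sum over injections of `k` indices into `N`, each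
contributing the same marginal (`IsComplexGinibre.lintegral_prod_count`). Conversely, disjoint boxes
determine the correlation functions off the null set of coinciding points. -/

theorem someEigenvalueList_spec {N : ℕ} (A : Matrix (Fin N) (Fin N) ℂ) :
    IsEigenvalueList A (someEigenvalueList A) :=
  (exists_isEigenvalueList A).choose_spec

theorem charpoly_eq_prod_of_isEigenvalueList {N : ℕ} {A : Matrix (Fin N) (Fin N) ℂ}
    {v : Fin N → ℂ} (h : IsEigenvalueList A v) :
    A.charpoly = ∏ i, (Polynomial.X - Polynomial.C (v i)) := by
  rw [(IsAlgClosed.splits A.charpoly).eq_prod_roots_of_monic A.charpoly_monic,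
    ← (show _ = A.charpoly.roots from h), Multiset.map_map]
  rfl

theorem roots_prod_X_sub_C_eq_map {N : ℕ} (v : Fin N → ℂ) :
    (∏ i, (Polynomial.X - Polynomial.C (v i))).roots = Finset.univ.val.map v := by
  rw [← Polynomial.roots_multiset_prod_X_sub_C (Finset.univ.val.map v), Multiset.map_map]
  rfl

theorem isEigenvalueList_of_charpoly_eq_prod {N : ℕ} {A : Matrix (Fin N) (Fin N) ℂ}
    {v : Fin N → ℂ} (h : A.charpoly = ∏ i, (Polynomial.X - Polynomial.C (v i))) :
    IsEigenvalueList A v := by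
  unfold IsEigenvalueList
  rw [h, roots_prod_X_sub_C_eq_map]

/-- Equal multisets of values have fibres of equal cardinality, and bijections between the fibres
glue to a permutation. -/
theorem exists_perm_of_map_eq {ι β : Type*} [Fintype ι] {v w : ι → β}
    (h : Finset.univ.val.map v = Finset.univ.val.map w) : ∃ σ : Equiv.Perm ι, v = w ∘ σ := by
  classical
  have hc : ∀ b, Fintype.card {i // v i = b} = Fintype.card {i // w i = b} := by
    intro b
    have := congrArg (Multiset.count b) h
    rw [Multiset.count_map, Multiset.count_map] at this
    rw [Fintype.card_subtype, Fintype.card_subtype]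
    simpa [eq_comm, Finset.card, Finset.filter] using this
  have E : ∀ b, {i // v i = b} ≃ {i // w i = b} := fun b => Fintype.equivOfCardEq (hc b)
  refine ⟨((Equiv.sigmaFiberEquiv v).symm.trans (Equiv.sigmaCongrRight E)).trans
    (Equiv.sigmaFiberEquiv w), ?_⟩
  funext i
  exact ((E (v i)) ⟨i, rfl⟩).2.symm

theorem exists_perm_of_prod_eq {N : ℕ} {v w : Fin N → ℂ}
    (h : ∏ i, (Polynomial.X - Polynomial.C (v i)) = ∏ i, (Polynomial.X - Polynomial.C (w i))) :
    ∃ σ : Equiv.Perm (Fin N), v = w ∘ σ := by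
  apply exists_perm_of_map_eq
  rw [← roots_prod_X_sub_C_eq_map, h, roots_prod_X_sub_C_eq_map]

theorem IsEigenvalueList.exists_perm {N : ℕ} {A : Matrix (Fin N) (Fin N) ℂ} {v w : Fin N → ℂ}
    (hv : IsEigenvalueList A v) (hw : IsEigenvalueList A w) :
    ∃ σ : Equiv.Perm (Fin N), v = w ∘ σ :=
  exists_perm_of_map_eq (hv.trans hw.symm)

theorem mem_spectrum_iff_of_isEigenvalueList {N : ℕ} {A : Matrix (Fin N) (Fin N) ℂ}
    {v : Fin N → ℂ} (h : IsEigenvalueList A v) (z : ℂ) : z ∈ spectrum ℂ A ↔ ∃ i, v i = z := by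
  rw [Matrix.mem_spectrum_iff_isRoot_charpoly, charpoly_eq_prod_of_isEigenvalueList h,
    Polynomial.IsRoot, Polynomial.eval_prod, Finset.prod_eq_zero_iff]
  simp [sub_eq_zero, eq_comm]

theorem det_sub_eq_prod_of_isEigenvalueList {N : ℕ} {A : Matrix (Fin N) (Fin N) ℂ}
    {v : Fin N → ℂ} (h : IsEigenvalueList A v) (z : ℂ) :
    (Matrix.scalar (Fin N) z - A).det = ∏ i, (z - v i) := by
  rw [← Matrix.eval_charpoly, charpoly_eq_prod_of_isEigenvalueList h, Polynomial.eval_prod]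
  simp

/-- A measurable symmetric function of the eigenvalues is a measurable function of the matrix. -/
theorem measurable_symmetric_eigenvalues {α β : Type*} [MeasurableSpace α] [StandardBorelSpace α]
    [MeasurableSpace β] {N : ℕ} {f : α × (Fin N → ℂ) → β} (hf : Measurable f)
    (hs : ∀ a z (σ : Equiv.Perm (Fin N)), f (a, z ∘ σ) = f (a, z)) :
    Measurable fun p : α × (Fin N → Fin N → ℂ) =>
      f (p.1, someEigenvalueList (Matrix.of p.2)) := by
  -- A monic polynomial is determined by its values at the natural numbers, so `e` separates vectors
  -- up to permutation. On eigenvalue lists these values are `det (k - A)`, which is continuous in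
  -- `A`.
  let e : α × (Fin N → ℂ) → α × (ℕ → ℂ) := fun p => (p.1, fun k => ∏ i, ((k : ℂ) - p.2 i))
  have he : Measurable e := by fun_prop
  have hinj : ∀ a z w, e (a, z) = e (a, w) → f (a, z) = f (a, w) := by
    intro a z w h
    have hp : ∏ i, (Polynomial.X - Polynomial.C (z i))
        = ∏ i, (Polynomial.X - Polynomial.C (w i)) := by
      apply Polynomial.eq_of_infinite_eval_eq
      apply Set.Infinite.mono (s := Set.range ((↑) : ℕ → ℂ))
      · rintro _ ⟨k, rfl⟩
        have := congrFun (congrArg Prod.snd h) k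
        simpa [Polynomial.eval_prod, e] using this
      · exact Set.infinite_range_of_injective Nat.cast_injective
    obtain ⟨σ, rfl⟩ := exists_perm_of_prod_eq hp
    exact hs a w σ
  have hE : Measurable (Set.rangeFactorization e) := he.subtype_mk
  let g : Set.range e → β := fun y => f y.2.choose
  have hg : g ∘ Set.rangeFactorization e = f := by
    funext p
    have h := (Set.rangeFactorization e p).2.choose_spec
    set q := (Set.rangeFactorization e p).2.choose
    have h1 : q.1 = p.1 := congrArg (fun y => y.1) h
    have h2 : q = (p.1, q.2) := by rw [← h1]
    change f q = f p
    rw [h2] at h ⊢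
    exact hinj _ _ _ h
  have hgm : Measurable g := by
    -- Since the source is standard Borel, the factor of a measurable function through a measurable
    -- surjection is measurable.
    rw [← hE.measurable_comp_iff_of_surjective Set.rangeFactorization_surjective, hg]
    exact hf
  have hm : Measurable fun p : α × (Fin N → Fin N → ℂ) =>
      Set.rangeFactorization e (p.1, someEigenvalueList (Matrix.of p.2)) := by
    apply Measurable.subtype_mk
    refine measurable_fst.prodMk (measurable_pi_lambda _ fun k => ?_)
    simp_rw [← det_sub_eq_prod_of_isEigenvalueList (someEigenvalueList_spec _)]
    have hc : Continuous fun c : Fin N → Fin N → ℂ =>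
        (Matrix.scalar (Fin N) (k : ℂ) - Matrix.of c).det :=
      Continuous.matrix_det (continuous_const.sub continuous_id)
    exact hc.measurable.comp measurable_snd
  have := hgm.comp hm
  rw [← hg]
  exact this


/-! ### Matrices with a prescribed left eigenvector -/

/-- The vector `(1, x₁, …, xₙ)` attached to `x = (x₀, x₁, …, xₙ)`. -/
def eigenvectorOf {n : ℕ} (x : Fin (n + 1) → ℂ) : Fin (n + 1) → ℂ := Fin.cons 1 (Fin.tail x)

/-- The first row of the matrix with remaining rows `Y` for which `(1, x₁, …, xₙ)` is a left
eigenvector of eigenvalue `x₀`. -/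
def eigenRow {n : ℕ} (Y : Fin n → Fin (n + 1) → ℂ) (x : Fin (n + 1) → ℂ) : Fin (n + 1) → ℂ :=
  x 0 • eigenvectorOf x - ∑ j, x j.succ • Y j

/-- The rows of the matrix with last rows `Y` for which `(1, x₁, …, xₙ)` is a left eigenvector
of eigenvalue `x₀`. -/
def eigenRows {n : ℕ} (x : Fin (n + 1) → ℂ) (Y : Fin n → Fin (n + 1) → ℂ) :
    Fin (n + 1) → Fin (n + 1) → ℂ :=
  Fin.cons (eigenRow Y x) Y

theorem vecMul_of_eq_sum {ι κ : Type*} [Fintype ι] (c : ι → κ → ℂ) (x : ι → ℂ) :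
    Matrix.vecMul x (Matrix.of c) = ∑ i, x i • c i := by
  ext k
  simp [Matrix.vecMul, dotProduct, Finset.sum_apply]

theorem vecMul_eigenRows {n : ℕ} (x : Fin (n + 1) → ℂ) (Y : Fin n → Fin (n + 1) → ℂ) :
    Matrix.vecMul (eigenvectorOf x) (Matrix.of (eigenRows x Y)) = x 0 • eigenvectorOf x := by
  rw [vecMul_of_eq_sum, Fin.sum_univ_succ]
  simp [eigenvectorOf, eigenRows, eigenRow, Fin.tail]

theorem eigenRow_eq_of_vecMul {n : ℕ} {x r : Fin (n + 1) → ℂ} {Y : Fin n → Fin (n + 1) → ℂ}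
    (h : Matrix.vecMul (eigenvectorOf x) (Matrix.of (Fin.cons r Y : Fin (n + 1) → _))
      = x 0 • eigenvectorOf x) : eigenRow Y x = r := by
  rw [vecMul_of_eq_sum, Fin.sum_univ_succ] at h
  simp only [eigenvectorOf, Fin.cons_zero, one_smul, Fin.cons_succ, Fin.tail] at h
  rw [eigenRow, sub_eq_iff_eq_add]
  exact h.symm

/-- As `e 0 = 1`, replacing row `0` of `z - A` by the combination of all rows with coefficients `e`
preserves the determinant. The new row is `(z - l) • e`. -/
theorem det_sub_eq_mul_of_vecMul {n : ℕ} {A : Matrix (Fin (n + 1)) (Fin (n + 1)) ℂ}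
    {e : Fin (n + 1) → ℂ} {l : ℂ} (he : e 0 = 1) (h : Matrix.vecMul e A = l • e) (z : ℂ) :
    (Matrix.scalar (Fin (n + 1)) z - A).det
      = (z - l) * ((Matrix.scalar (Fin (n + 1)) z - A).updateRow 0 e).det := by
  have h1 := Matrix.det_updateRow_sum (Matrix.scalar (Fin (n + 1)) z - A) 0 e
  rw [he, one_smul] at h1
  rw [← h1, ← Matrix.det_updateRow_smul]
  congr 2
  have h2 : ∑ k, e k • (Matrix.scalar (Fin (n + 1)) z - A) k
      = Matrix.vecMul e (Matrix.scalar (Fin (n + 1)) z - A) :=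
    (vecMul_of_eq_sum (fun i => (Matrix.scalar (Fin (n + 1)) z - A) i) e).symm
  rw [h2, Matrix.vecMul_sub, h, Matrix.scalar_apply]
  ext k
  simp
  ring

/-- Divide the factorization `det_sub_eq_mul_of_vecMul` by `z - l` and let `z` tend to `l`. -/
theorem eval_derivative_charpoly_of_vecMul {n : ℕ} {A : Matrix (Fin (n + 1)) (Fin (n + 1)) ℂ}
    {e : Fin (n + 1) → ℂ} {l : ℂ} (he : e 0 = 1) (h : Matrix.vecMul e A = l • e) :
    A.charpoly.derivative.eval l = ((Matrix.scalar (Fin (n + 1)) l - A).updateRow 0 e).det := by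
  have h1 := A.charpoly.hasDerivAt l
  refine h1.unique ?_
  rw [hasDerivAt_iff_tendsto_slope]
  have hc : Continuous fun z : ℂ => ((Matrix.scalar (Fin (n + 1)) z - A).updateRow 0 e).det := by
    apply Continuous.matrix_det
    refine Continuous.matrix_updateRow 0 (Continuous.sub ?_ continuous_const) continuous_const
    exact Continuous.matrix_diagonal (continuous_pi fun _ => continuous_id)
  refine ((hc.tendsto l).mono_left nhdsWithin_le_nhds).congr' ?_
  filter_upwards [self_mem_nhdsWithin] with z hz
  have hz' : z - l ≠ 0 := sub_ne_zero.mpr hz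
  rw [slope_def_field, Matrix.eval_charpoly, Matrix.eval_charpoly, det_sub_eq_mul_of_vecMul he h,
    det_sub_eq_mul_of_vecMul he h, sub_self, zero_mul, sub_zero, mul_div_cancel_left₀ _ hz']

/-- The Jacobian matrix of `eigenRow Y`. -/
def eigenRowJacobian {n : ℕ} (Y : Fin n → Fin (n + 1) → ℂ) (x : Fin (n + 1) → ℂ) :
    Matrix (Fin (n + 1)) (Fin (n + 1)) ℂ :=
  (Matrix.scalar (Fin (n + 1)) (x 0) - Matrix.of (eigenRows x Y)).updateRow 0 (eigenvectorOf x)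

/-- The derivative in `x₀` is the vector `(1, x₁, …, xₙ)`, and the derivative in `xⱼ` is `x₀` times
the `j`-th unit vector minus the row `Yⱼ`. These are the rows of the Jacobian matrix, whence the
transpose. -/
theorem hasFDerivAt_eigenRow {n : ℕ} (Y : Fin n → Fin (n + 1) → ℂ) (x : Fin (n + 1) → ℂ) :
    HasFDerivAt (eigenRow Y)
      (LinearMap.toContinuousLinearMap (Matrix.toLin' (eigenRowJacobian Y x).transpose)) x := by
  rw [hasFDerivAt_pi']
  intro i
  have h0 := hasFDerivAt_apply (𝕜 := ℂ) (F' := fun _ : Fin (n + 1) => ℂ) 0 x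
  have hs := fun i => HasFDerivAt.fun_sum (u := Finset.univ) fun (j : Fin n) _ =>
    (hasFDerivAt_apply (𝕜 := ℂ) (F' := fun _ : Fin (n + 1) => ℂ) j.succ x).mul_const (Y j i)
  refine Fin.cases ?_ (fun k => ?_) i
  · have hE : (fun y : Fin (n + 1) → ℂ => eigenRow Y y 0)
        = fun y => y 0 - ∑ j : Fin n, y j.succ * Y j 0 := by
      funext y
      simp [eigenRow, eigenvectorOf, Finset.sum_apply]
    rw [hE]
    refine (h0.sub (hs 0)).congr_fderiv ?_
    ext v
    simp [eigenRowJacobian, Matrix.mulVec, dotProduct, Fin.sum_univ_succ, eigenRows,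
      eigenvectorOf, mul_comm, sub_eq_add_neg]
  · have hE : (fun y : Fin (n + 1) → ℂ => eigenRow Y y k.succ)
        = fun y => y 0 * y k.succ - ∑ j : Fin n, y j.succ * Y j k.succ := by
      funext y
      simp [eigenRow, eigenvectorOf, Finset.sum_apply, Fin.tail]
    rw [hE]
    have hk := hasFDerivAt_apply (𝕜 := ℂ) (F' := fun _ : Fin (n + 1) => ℂ) k.succ x
    refine ((h0.mul hk).sub (hs k.succ)).congr_fderiv ?_
    ext v
    simp [eigenRowJacobian, Matrix.mulVec, dotProduct, Fin.sum_univ_succ, eigenRows,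
      eigenvectorOf, mul_comm, Fin.tail, Matrix.diagonal, mul_sub,
      Finset.sum_sub_distrib]
    ring

theorem det_restrictScalars_toLin' {n : ℕ} (J : Matrix (Fin n) (Fin n) ℂ) :
    ((LinearMap.toContinuousLinearMap (Matrix.toLin' J)).restrictScalars ℝ).det = ‖J.det‖ ^ 2 := by
  rw [ContinuousLinearMap.det]
  have := LinearMap.det_restrictScalars (R := ℝ) (f := Matrix.toLin' J)
  rw [LinearMap.det_toLin', Algebra.norm_complex_apply, Complex.normSq_eq_norm_sq] at this
  exact this

/-- The source of the squared Vandermonde factor: a complex linear map has real determinant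
`|det|²`, and the complex Jacobian is the derivative of the characteristic polynomial at the chosen
eigenvalue. -/
theorem hasFDerivAt_eigenRow_real {n : ℕ} (Y : Fin n → Fin (n + 1) → ℂ) (x : Fin (n + 1) → ℂ) :
    ∃ f' : (Fin (n + 1) → ℂ) →L[ℝ] (Fin (n + 1) → ℂ), HasFDerivAt (eigenRow Y) f' x ∧
      f'.det = ‖(Matrix.of (eigenRows x Y)).charpoly.derivative.eval (x 0)‖ ^ 2 := by
  refine ⟨_, (hasFDerivAt_eigenRow Y x).restrictScalars ℝ, ?_⟩
  rw [det_restrictScalars_toLin', Matrix.det_transpose,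
    eval_derivative_charpoly_of_vecMul (by simp [eigenvectorOf]) (vecMul_eigenRows x Y)]
  rfl


/-! ### The top eigenvalue as a coordinate -/

/-- The lexicographic order of the complex numbers. -/
def LexLE (z w : ℂ) : Prop := z.re < w.re ∨ (z.re = w.re ∧ z.im ≤ w.im)

theorem LexLE.antisymm {z w : ℂ} (h : LexLE z w) (h' : LexLE w z) : z = w := by
  unfold LexLE at h h'
  apply Complex.ext
  · rcases h with h | h <;> rcases h' with h' | h' <;> linarith
  · rcases h with h | h <;> rcases h' with h' | h' <;> linarith

theorem exists_forall_lexLE {n : ℕ} (v : Fin (n + 1) → ℂ) : ∃ i, ∀ j, LexLE (v j) (v i) := by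
  obtain ⟨i, -, hi⟩ := Finset.exists_max_image Finset.univ
    (fun i => toLex ((v i).re, (v i).im)) ⟨0, Finset.mem_univ _⟩
  refine ⟨i, fun j => ?_⟩
  have := hi j (Finset.mem_univ j)
  rw [Prod.Lex.toLex_le_toLex] at this
  exact this

theorem measurableSet_lexLE : MeasurableSet {p : ℂ × ℂ | LexLE p.1 p.2} := by
  have h1 : Measurable fun p : ℂ × ℂ => p.1.re := Complex.measurable_re.comp measurable_fst
  have h2 : Measurable fun p : ℂ × ℂ => p.2.re := Complex.measurable_re.comp measurable_snd
  have h3 : Measurable fun p : ℂ × ℂ => p.1.im := Complex.measurable_im.comp measurable_fst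
  have h4 : Measurable fun p : ℂ × ℂ => p.2.im := Complex.measurable_im.comp measurable_snd
  exact (measurableSet_lt h1 h2).union
    ((measurableSet_eq_fun h1 h2).inter (measurableSet_le h3 h4))

/-- No left eigenvector of a square matrix with last rows `Y` has vanishing first coordinate. -/
def NoSingularEigenvector {n : ℕ} (Y : Fin n → Fin (n + 1) → ℂ) : Prop :=
  ∀ (w : Fin n → ℂ) (μ : ℂ), ∑ j, w j • Y j = μ • (Fin.cons 0 w : Fin (n + 1) → ℂ) → w = 0

/-- The vectors `x` for which `x₀` is the largest eigenvalue of the matrix `eigenRows x Y`. -/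
def topEigenvalueSet {n : ℕ} (Y : Fin n → Fin (n + 1) → ℂ) : Set (Fin (n + 1) → ℂ) :=
  {x | ∀ i, LexLE (someEigenvalueList (Matrix.of (eigenRows x Y)) i) (x 0)}

/-- The matrix determines its top eigenvalue, hence `x₀`. Two eigenvectors for it with first
coordinate `1` differ by a solution of the eigenvector equation with first coordinate `0`, which
must vanish. -/
theorem injOn_eigenRow {n : ℕ} {Y : Fin n → Fin (n + 1) → ℂ} (hY : NoSingularEigenvector Y) :
    Set.InjOn (eigenRow Y) (topEigenvalueSet Y) := by
  have hroot : ∀ x, ∃ i, someEigenvalueList (Matrix.of (eigenRows x Y)) i = x 0 := by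
    intro x
    have h := det_sub_eq_mul_of_vecMul (by simp [eigenvectorOf]) (vecMul_eigenRows x Y) (x 0)
    rw [sub_self, zero_mul, det_sub_eq_prod_of_isEigenvalueList (someEigenvalueList_spec _),
      Finset.prod_eq_zero_iff] at h
    obtain ⟨i, -, hi⟩ := h
    exact ⟨i, (sub_eq_zero.mp hi).symm⟩
  intro x hx y hy hxy
  have hA : eigenRows x Y = eigenRows y Y := by rw [eigenRows, eigenRows, hxy]
  have h0 : x 0 = y 0 := by
    obtain ⟨i, hi⟩ := hroot x
    obtain ⟨j, hj⟩ := hroot y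
    apply LexLE.antisymm
    · have := hy i
      rwa [← hA, hi] at this
    · have := hx j
      rwa [hA, hj] at this
  have hw := hY (Fin.tail x - Fin.tail y) (x 0) (by
    have h1 : x 0 • eigenvectorOf x - ∑ j, x j.succ • Y j
      = y 0 • eigenvectorOf y - ∑ j, y j.succ • Y j := hxy
    have h2 : (Fin.cons 0 (Fin.tail x - Fin.tail y) : Fin (n + 1) → ℂ)
        = eigenvectorOf x - eigenvectorOf y := by
      ext k
      refine Fin.cases ?_ (fun k => ?_) k <;> simp [eigenvectorOf]
    rw [h2, smul_sub]
    nth_rewrite 2 [h0]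
    simp only [Pi.sub_apply, Fin.tail, sub_smul, Finset.sum_sub_distrib]
    rw [sub_eq_sub_iff_add_eq_add] at h1 ⊢
    rw [h1]
    exact add_comm _ _)
  ext k
  refine Fin.cases h0 (fun k => ?_) k
  exact sub_eq_zero.mp (congrFun hw k)

/-- Take a left eigenvector for the top eigenvalue. Its first coordinate is nonzero by the
assumption on `Y`, so it can be normalized to `1`. -/
theorem image_eigenRow {n : ℕ} {Y : Fin n → Fin (n + 1) → ℂ} (hY : NoSingularEigenvector Y) :
    eigenRow Y '' topEigenvalueSet Y = Set.univ := by
  refine Set.eq_univ_of_forall fun r => ?_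
  set A : Matrix (Fin (n + 1)) (Fin (n + 1)) ℂ := Matrix.of (Fin.cons r Y) with hA
  obtain ⟨i, hi⟩ := exists_forall_lexLE (someEigenvalueList A)
  set l := someEigenvalueList A i with hl
  have hdet : (Matrix.scalar (Fin (n + 1)) l - A).det = 0 := by
    rw [det_sub_eq_prod_of_isEigenvalueList (someEigenvalueList_spec A), Finset.prod_eq_zero_iff]
    exact ⟨i, Finset.mem_univ _, sub_self _⟩
  obtain ⟨u, hu0, hu⟩ := Matrix.exists_vecMul_eq_zero_iff.mpr hdet
  have hu' : Matrix.vecMul u A = l • u := by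
    rw [Matrix.vecMul_sub, sub_eq_zero] at hu
    rw [← hu]
    ext k
    simp [mul_comm]
  have hu1 : u 0 ≠ 0 := by
    intro h
    have hc : (Fin.cons 0 (Fin.tail u) : Fin (n + 1) → ℂ) = u := by
      rw [← h, Fin.cons_self_tail]
    apply hu0
    rw [← hc, hY (Fin.tail u) l ?_]
    · ext k
      refine Fin.cases ?_ (fun k => ?_) k <;> simp
    · rw [hc, ← hu', hA, vecMul_of_eq_sum, Fin.sum_univ_succ, h]
      simp [Fin.tail]
  let x : Fin (n + 1) → ℂ := Fin.cons l fun j => (u 0)⁻¹ * u j.succ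
  have hx : eigenvectorOf x = (u 0)⁻¹ • u := by
    ext k
    refine Fin.cases ?_ (fun k => ?_) k <;> simp [eigenvectorOf, x, hu1]
  have hr : eigenRow Y x = r := by
    apply eigenRow_eq_of_vecMul
    rw [← hA, hx, Matrix.smul_vecMul, hu', smul_comm]
    rfl
  refine ⟨x, fun j => ?_, hr⟩
  rw [eigenRows, hr]
  exact hi j

/-- Change of variables from the first row to the top eigenvalue and its left eigenvector. -/
theorem lintegral_eq_setLIntegral_topEigenvalueSet {n : ℕ} {Y : Fin n → Fin (n + 1) → ℂ}
    (hY : NoSingularEigenvector Y) (hS : MeasurableSet (topEigenvalueSet Y))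
    (g : (Fin (n + 1) → Fin (n + 1) → ℂ) → ℝ≥0∞) :
    ∫⁻ r, g (Fin.cons r Y) = ∫⁻ x in topEigenvalueSet Y,
      ENNReal.ofReal (‖(Matrix.of (eigenRows x Y)).charpoly.derivative.eval (x 0)‖ ^ 2)
        * g (eigenRows x Y) := by
  choose f' hf' hdet using hasFDerivAt_eigenRow_real Y
  rw [← setLIntegral_univ, ← image_eigenRow hY,
    lintegral_image_eq_lintegral_abs_det_fderiv_mul volume hS
      (fun x _ => (hf' x).hasFDerivWithinAt) (injOn_eigenRow hY)]
  simp_rw [hdet, abs_of_nonneg (sq_nonneg (‖_‖ : ℝ))]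
  rfl

/-! ### Linear changes of variables and generic last rows -/

instance isAddHaarMeasure_volume_pi_pi (m n : ℕ) :
    (volume : Measure (Fin m → Fin n → ℂ)).IsAddHaarMeasure :=
  Measure.pi.isAddHaarMeasure _

instance isAddHaarMeasure_volume_prod_pi_pi (n : ℕ) :
    (volume : Measure ((Fin n → ℂ) × (Fin n → Fin n → ℂ))).IsAddHaarMeasure :=
  Measure.prod.instIsAddHaarMeasure _ _

/-- Uniqueness of Haar measure. The constant need not be known, and `g` need not be measurable
because `L` is a homeomorphism. -/
theorem exists_lintegral_eq_mul_lintegral_comp {E F : Type*} [NormedAddCommGroup E]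
    [NormedSpace ℝ E] [MeasureSpace E] [BorelSpace E] [FiniteDimensional ℝ E]
    [(volume : Measure E).IsAddHaarMeasure] [NormedAddCommGroup F]
    [NormedSpace ℝ F] [MeasureSpace F] [BorelSpace F] [FiniteDimensional ℝ F]
    [(volume : Measure F).IsAddHaarMeasure] (L : E ≃ₗ[ℝ] F) :
    ∃ c : ℝ≥0, ∀ g : F → ℝ≥0∞, ∫⁻ y, g y = c * ∫⁻ x, g (L x) := by
  let L' : E ≃L[ℝ] F := L.toContinuousLinearEquiv
  have : ((volume : Measure E).map L').IsAddHaarMeasure := inferInstance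
  refine ⟨(volume : Measure F).addHaarScalarFactor ((volume : Measure E).map L'), fun g => ?_⟩
  conv_lhs => rw [Measure.isAddLeftInvariant_eq_smul (volume : Measure F)
    ((volume : Measure E).map L')]
  rw [lintegral_smul_measure, ENNReal.smul_def, smul_eq_mul]
  congr 1
  exact (lintegral_map_equiv g L'.toHomeomorph.toMeasurableEquiv)

/-- Adjoining a first column `b` to a family of rows `D`. -/
def consColumn (n : ℕ) :
    ((Fin n → ℂ) × (Fin n → Fin n → ℂ)) ≃ₗ[ℝ] (Fin n → Fin (n + 1) → ℂ) where
  toFun p j := Fin.cons (p.1 j) (p.2 j)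
  invFun Y := (fun j => Y j 0, fun j => Fin.tail (Y j))
  left_inv p := by simp
  right_inv Y := by simp
  map_add' p q := by
    ext j k
    refine Fin.cases ?_ (fun k => ?_) k <;> simp
  map_smul' c p := by
    ext j k
    refine Fin.cases ?_ (fun k => ?_) k <;> simp

/-- The complement is closed. By homogeneity `w` may be taken on the unit sphere; eliminating `μ`,
the equation says that all `2 × 2` minors of two vectors vanish, a closed condition, and projection
along a compact factor is a closed map. -/
theorem measurableSet_noSingularEigenvector (n : ℕ) :
    MeasurableSet {Y : Fin n → Fin (n + 1) → ℂ | NoSingularEigenvector Y} := by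
  let S := Metric.sphere (0 : Fin n → ℂ) 1
  let T : Set (S × (Fin n → Fin (n + 1) → ℂ)) := {p | ∀ i k,
    (∑ j, p.1.1 j • p.2 j) i * (Fin.cons 0 p.1.1 : Fin (n + 1) → ℂ) k
      = (∑ j, p.1.1 j • p.2 j) k * (Fin.cons 0 p.1.1 : Fin (n + 1) → ℂ) i}
  have hT : IsClosed T := by
    have h1 : ∀ i, Continuous fun p : S × (Fin n → Fin (n + 1) → ℂ) =>
        (∑ j, p.1.1 j • p.2 j) i := by
      intro i
      simp only [Finset.sum_apply, Pi.smul_apply]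
      have hv : Continuous fun p : S × (Fin n → Fin (n + 1) → ℂ) => p.1.1 :=
        continuous_subtype_val.comp continuous_fst
      exact continuous_finsetSum _ fun j _ => ((continuous_apply j).comp hv).smul
        ((continuous_apply_apply j i).comp continuous_snd)
    have h2 : ∀ i, Continuous fun p : S × (Fin n → Fin (n + 1) → ℂ) =>
        (Fin.cons 0 p.1.1 : Fin (n + 1) → ℂ) i := by
      intro i
      refine Fin.cases ?_ (fun k => ?_) i
      · exact continuous_const
      · simp only [Fin.cons_succ]
        exact (continuous_apply k).comp (continuous_subtype_val.comp continuous_fst)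
    simp only [T, Set.ofPred_forall]
    exact isClosed_iInter fun i => isClosed_iInter fun k =>
      isClosed_eq ((h1 i).mul (h2 k)) ((h1 k).mul (h2 i))
  have hE : {Y : Fin n → Fin (n + 1) → ℂ | NoSingularEigenvector Y} = (Prod.snd '' T)ᶜ := by
    ext Y
    constructor
    · rintro hY ⟨⟨⟨w, hw⟩, Y'⟩, hT, rfl⟩
      have hw0 : w ≠ 0 := by
        rintro rfl
        simp [S] at hw
      obtain ⟨k, hk⟩ := Function.ne_iff.mp hw0
      refine hw0 (hY w ((∑ j, w j • Y' j) k.succ / w k) ?_)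
      ext i
      have := hT i k.succ
      simp only [Fin.cons_succ] at this
      rw [Pi.smul_apply, smul_eq_mul, div_mul_eq_mul_div, eq_div_iff hk]
      exact this
    · intro hY w μ hw
      by_contra hw0
      have hn : ‖w‖ ≠ 0 := norm_ne_zero_iff.mpr hw0
      refine hY ⟨(⟨((‖w‖⁻¹ : ℝ) : ℂ) • w, ?_⟩, Y), ?_, rfl⟩
      · simp [S, norm_smul, hn]
      · have h3 : ∑ j, (((‖w‖⁻¹ : ℝ) : ℂ) • w) j • Y j
            = ((‖w‖⁻¹ : ℝ) : ℂ) • μ • (Fin.cons 0 w : Fin (n + 1) → ℂ) := by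
          rw [← hw, Finset.smul_sum]
          simp [smul_smul]
        have h4 : (Fin.cons 0 (((‖w‖⁻¹ : ℝ) : ℂ) • w) : Fin (n + 1) → ℂ)
            = ((‖w‖⁻¹ : ℝ) : ℂ) • (Fin.cons 0 w : Fin (n + 1) → ℂ) := by
          ext k
          refine Fin.cases ?_ (fun k => ?_) k <;> simp
        intro i k
        rw [h3, h4]
        simp only [Pi.smul_apply, smul_eq_mul]
        ring
  rw [hE]
  exact (isClosedMap_snd_of_compactSpace _ hT).measurableSet.compl

/-- A singular `w` is a left eigenvector of `D` with `∑ wⱼ bⱼ = 0`. If the spectrum of `D` is simple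
there are only `n` candidates up to scaling, so a bad `b` lies in one of `n` hyperplanes. -/
theorem ae_noSingularEigenvector_of_injective {n : ℕ} (D : Fin n → Fin n → ℂ)
    (hD : Function.Injective (someEigenvalueList (Matrix.of D))) :
    ∀ᵐ b : Fin n → ℂ, NoSingularEigenvector (consColumn n (b, D)) := by
  set v := someEigenvalueList (Matrix.of D) with hv
  have hex : ∀ i, ∃ u : Fin n → ℂ, u ≠ 0 ∧ Matrix.vecMul u (Matrix.of D) = v i • u := by
    intro i
    have hdet : (Matrix.scalar (Fin n) (v i) - Matrix.of D).det = 0 := by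
      rw [det_sub_eq_prod_of_isEigenvalueList (someEigenvalueList_spec _),
        Finset.prod_eq_zero_iff]
      exact ⟨i, Finset.mem_univ _, sub_self _⟩
    obtain ⟨u, hu0, hu⟩ := Matrix.exists_vecMul_eq_zero_iff.mpr hdet
    refine ⟨u, hu0, ?_⟩
    rw [Matrix.vecMul_sub, sub_eq_zero] at hu
    rw [← hu]
    ext k
    simp [mul_comm]
  choose u hu0 hu using hex
  let T : Module.End ℂ (Fin n → ℂ) := Matrix.toLin' (Matrix.of D).transpose
  have hT : ∀ w, T w = Matrix.vecMul w (Matrix.of D) := fun w => by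
    simp [T, Matrix.mulVec_transpose]
  have hli : LinearIndependent ℂ u :=
    Module.End.eigenvectors_linearIndependent' T v hD u fun i =>
      ⟨Module.End.mem_eigenspace_iff.mpr (by rw [hT, hu]), hu0 i⟩
  have hspan := hli.span_eq_top_of_card_eq_finrank' (by simp)
  have key : ∀ b : Fin n → ℂ, ¬ NoSingularEigenvector (consColumn n (b, D)) →
      ∃ i, ∑ j, u i j * b j = 0 := by
    intro b hb
    unfold NoSingularEigenvector at hb
    push Not at hb
    obtain ⟨w, μ, hw, hw0⟩ := hb
    have hwD : T w = μ • w := by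
      rw [hT, vecMul_of_eq_sum]
      ext k
      have := congrFun hw k.succ
      simpa [consColumn, Finset.sum_apply] using this
    have hwb : ∑ j, w j * b j = 0 := by
      have := congrFun hw 0
      simpa [consColumn, Finset.sum_apply] using this
    have hmem : w ∈ Submodule.span ℂ (Set.range u) := by rw [hspan]; trivial
    obtain ⟨c, hc⟩ := (Submodule.mem_span_range_iff_exists_fun ℂ).mp hmem
    -- In the eigenbasis, `c i` can be nonzero only when `v i = μ`, which holds for at most one `i`.
    have hz : ∑ i, (c i * (v i - μ)) • u i = 0 := by
      have h1 : T w - μ • w = 0 := sub_eq_zero.mpr hwD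
      rw [← hc, map_sum, Finset.smul_sum, ← Finset.sum_sub_distrib] at h1
      rw [← h1]
      refine Finset.sum_congr rfl fun i _ => ?_
      rw [map_smul, hT, hu, smul_smul, smul_smul, ← sub_smul]
      ring_nf
    have hz' := Fintype.linearIndependent_iff.mp hli _ hz
    have hci : ∃ i, c i ≠ 0 := by
      by_contra! h
      apply hw0
      rw [← hc]
      simp [h]
    obtain ⟨i, hi⟩ := hci
    have hvi : v i = μ := by
      have := (mul_eq_zero.mp (hz' i)).resolve_left hi
      exact sub_eq_zero.mp this
    have hwi : w = c i • u i := by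
      rw [← hc]
      refine Finset.sum_eq_single i (fun j _ hj => ?_) (by simp)
      have := (mul_eq_zero.mp (hz' j)).resolve_right
        (sub_ne_zero.mpr fun h => hj (hD (h.trans hvi.symm)))
      rw [this, zero_smul]
    refine ⟨i, ?_⟩
    rw [hwi] at hwb
    simp only [Pi.smul_apply, smul_eq_mul, mul_assoc, ← Finset.mul_sum] at hwb
    exact (mul_eq_zero.mp hwb).resolve_left hi
  refine measure_mono_null (t := ⋃ i, {b : Fin n → ℂ | ∑ j, u i j * b j = 0}) ?_ ?_
  · intro b hb
    exact Set.mem_iUnion.mpr (key b hb)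
  · refine measure_iUnion_null fun i => ?_
    let ℓ : (Fin n → ℂ) →ₗ[ℝ] ℂ :=
      (∑ j, u i j • (LinearMap.proj j : (Fin n → ℂ) →ₗ[ℂ] ℂ)).restrictScalars ℝ
    have hℓ : ∀ b, ℓ b = ∑ j, u i j * b j := fun b => by simp [ℓ]
    have : {b : Fin n → ℂ | ∑ j, u i j * b j = 0} = (LinearMap.ker ℓ : Set (Fin n → ℂ)) := by
      ext b
      simp [hℓ]
    rw [this]
    refine Measure.addHaar_submodule _ _ fun htop => hu0 i ?_
    ext j
    have := LinearMap.ker_eq_top.mp htop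
    have := congrFun (congrArg DFunLike.coe this) (Pi.single j 1)
    rw [hℓ] at this
    simpa [Pi.single_apply] using this

theorem ae_noSingularEigenvector {n : ℕ}
    (h : ∀ᵐ D : Fin n → Fin n → ℂ, Function.Injective (someEigenvalueList (Matrix.of D))) :
    ∀ᵐ Y : Fin n → Fin (n + 1) → ℂ, NoSingularEigenvector Y := by
  obtain ⟨c, hc⟩ := exists_lintegral_eq_mul_lintegral_comp (consColumn n)
  have hm := measurableSet_noSingularEigenvector n
  have hmL : Measurable (consColumn n) :=
    (consColumn n).toContinuousLinearEquiv.continuous.measurable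
  have h1 : ∀ᵐ p : (Fin n → ℂ) × (Fin n → Fin n → ℂ),
      NoSingularEigenvector (consColumn n p) := by
    have hm' : MeasurableSet {p : (Fin n → ℂ) × (Fin n → Fin n → ℂ) |
        NoSingularEigenvector (consColumn n (p.1, p.2))} := hmL hm
    rw [Measure.volume_eq_prod, Measure.ae_prod_iff_ae_ae hm', Measure.ae_ae_comm hm']
    filter_upwards [h] with D hD
    exact ae_noSingularEigenvector_of_injective D hD
  have h2 := hc ({Y | NoSingularEigenvector Y}ᶜ.indicator 1)
  rw [lintegral_indicator_one hm.compl] at h2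
  have h3 : ∫⁻ p, {Y | NoSingularEigenvector Y}ᶜ.indicator 1 (consColumn n p) = (0 : ℝ≥0∞) := by
    rw [← lintegral_zero]
    apply lintegral_congr_ae
    filter_upwards [h1] with p hp
    simp [hp]
  rw [h3, mul_zero] at h2
  exact h2


/-! ### The density and its symmetry -/

theorem piFinSuccAbove_zero_symm_apply {E : Type*} [MeasurableSpace E] {n : ℕ}
    (p : E × (Fin n → E)) :
    (MeasurableEquiv.piFinSuccAbove (fun _ : Fin (n + 1) => E) 0).symm p = Fin.cons p.1 p.2 :=
  Fin.insertNth_zero' p.1 p.2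

theorem lintegral_fin_cons {E : Type*} [MeasureSpace E] [SigmaFinite (volume : Measure E)] {n : ℕ}
    {g : (Fin (n + 1) → E) → ℝ≥0∞} (hg : Measurable g) :
    ∫⁻ c, g c = ∫⁻ r : E, ∫⁻ Y : Fin n → E, g (Fin.cons r Y) := by
  have h := (volume_preserving_piFinSuccAbove (fun _ : Fin (n + 1) => E) 0).symm
  rw [← h.lintegral_comp hg, Measure.volume_eq_prod, lintegral_prod]
  · simp only [piFinSuccAbove_zero_symm_apply]
  · exact (hg.comp (MeasurableEquiv.measurable _)).aemeasurable

theorem measurable_fin_cons {E : Type*} [MeasurableSpace E] {n : ℕ} :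
    Measurable fun p : E × (Fin n → E) => (Fin.cons p.1 p.2 : Fin (n + 1) → E) := by
  have h := (MeasurableEquiv.piFinSuccAbove (fun _ : Fin (n + 1) => E) 0).symm.measurable
  rwa [show ⇑(MeasurableEquiv.piFinSuccAbove (fun _ : Fin (n + 1) => E) 0).symm
    = fun p => Fin.cons p.1 p.2 from funext piFinSuccAbove_zero_symm_apply] at h

theorem ginibreWeight_pos (z : ℂ) : 0 < ginibreWeight z :=
  mul_pos (inv_pos.mpr Real.pi_pos) (Real.exp_pos _)

theorem measurable_ginibreWeight : Measurable ginibreWeight := by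
  unfold ginibreWeight
  fun_prop

theorem ginibreDensity_nonneg (N : ℕ) (z : Fin N → ℂ) : 0 ≤ ginibreDensity N z := by
  have := fun z => (ginibreWeight_pos z).le
  unfold ginibreDensity
  refine mul_nonneg (div_nonneg (Finset.prod_nonneg fun _ _ => this _) ?_) ?_
  · positivity
  · positivity

theorem prod_norm_sub_sq_eq_vandermonde {N : ℕ} (z : Fin N → ℂ) :
    ∏ i, ∏ j ∈ Finset.Ioi i, ‖z i - z j‖ ^ 2 = ‖(Matrix.vandermonde z).det‖ ^ 2 := by
  simp_rw [Matrix.det_vandermonde, norm_prod, ← Finset.prod_pow, norm_sub_rev]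

theorem measurable_ginibreDensity (N : ℕ) : Measurable (ginibreDensity N) := by
  have := measurable_ginibreWeight
  unfold ginibreDensity
  fun_prop

theorem ginibreDensity_comp_perm {N : ℕ} (z : Fin N → ℂ) (σ : Equiv.Perm (Fin N)) :
    ginibreDensity N (z ∘ σ) = ginibreDensity N z := by
  unfold ginibreDensity
  rw [prod_norm_sub_sq_eq_vandermonde, prod_norm_sub_sq_eq_vandermonde]
  congr 1
  · congr 1
    exact Equiv.prod_comp σ fun k => ginibreWeight (z k)
  · have : Matrix.vandermonde (z ∘ σ) = (Matrix.vandermonde z).submatrix σ id := rfl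
    rw [this, Matrix.det_permute]
    rcases Int.units_eq_one_or (Equiv.Perm.sign σ) with h | h <;> simp [h]

theorem ginibreDensity_cons {n : ℕ} (l : ℂ) (z : Fin n → ℂ) :
    ginibreDensity (n + 1) (Fin.cons l z)
      = ginibreWeight l / (n + 1)! * (∏ i, ‖l - z i‖ ^ 2 * 1) * ginibreDensity n z := by
  unfold ginibreDensity
  rw [Fin.prod_univ_succ, Fin.prod_univ_succ, Finset.prod_Icc_succ_top (by omega)]
  simp only [Fin.cons_zero, Fin.cons_succ, Fin.prod_Ioi_zero, Fin.prod_Ioi_succ, mul_one]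
  have h1 : ∏ k ∈ Finset.Icc 1 n, (k ! : ℝ) ≠ 0 :=
    Finset.prod_ne_zero_iff.mpr fun k _ => by positivity
  have h2 : ((n + 1)! : ℝ) ≠ 0 := by positivity
  field_simp

theorem ae_injective (N : ℕ) : ∀ᵐ z : Fin N → ℂ, Function.Injective z := by
  refine measure_mono_null (t := ⋃ p : {p : Fin N × Fin N // p.1 ≠ p.2},
    {z : Fin N → ℂ | z p.1.1 = z p.1.2}) ?_ ?_
  · intro z hz
    simp only [Set.mem_compl_iff, Function.Injective, Set.mem_ofPred_eq] at hz
    push Not at hz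
    obtain ⟨i, j, hij, hne⟩ := hz
    exact Set.mem_iUnion.mpr ⟨⟨(i, j), hne⟩, hij⟩
  · refine measure_iUnion_null fun p => ?_
    obtain ⟨⟨i, j⟩, hij⟩ := p
    let l : (Fin N → ℂ) →ₗ[ℝ] ℂ := (LinearMap.proj i : (Fin N → ℂ) →ₗ[ℝ] ℂ) - LinearMap.proj j
    have hE : {z : Fin N → ℂ | z i = z j} = (LinearMap.ker l : Set (Fin N → ℂ)) := by
      ext z
      simp [l, sub_eq_zero]
    rw [hE]
    refine Measure.addHaar_submodule _ _ fun htop => ?_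
    have := congrFun (congrArg DFunLike.coe (LinearMap.ker_eq_top.mp htop)) (Pi.single i 1)
    simp [l, hij.symm] at this

theorem measurePreserving_comp_perm {ι E : Type*} [Fintype ι] [MeasureSpace E]
    [SigmaFinite (volume : Measure E)] (σ : Equiv.Perm ι) :
    MeasurePreserving (fun z : ι → E => z ∘ σ) volume volume := by
  have := volume_measurePreserving_piCongrLeft (fun _ : ι => E) σ.symm
  convert this using 1
  funext z
  ext i
  have h := Equiv.piCongrLeft_apply_apply (fun _ : ι => E) σ.symm z (σ i)
  rw [Equiv.symm_apply_apply] at h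
  exact h.symm

/-- The integral of a symmetric function restricted to the event that the first coordinate is
the largest. -/
theorem lintegral_symmetric_eq_mul {n : ℕ} {g : (Fin (n + 1) → ℂ) → ℝ≥0∞} (hg : Measurable g)
    (hs : ∀ z (σ : Equiv.Perm (Fin (n + 1))), g (z ∘ σ) = g z) :
    ∫⁻ z, g z = (n + 1) * ∫⁻ z, {z | ∀ i, LexLE (z i) (z 0)}.indicator g z := by
  have hmeas : ∀ j : Fin (n + 1), MeasurableSet {z : Fin (n + 1) → ℂ | ∀ i, LexLE (z i) (z j)} := by
    intro j
    simp only [Set.ofPred_forall]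
    refine MeasurableSet.iInter fun i => ?_
    have hp : Measurable fun z : Fin (n + 1) → ℂ => (z i, z j) := by fun_prop
    exact hp measurableSet_lexLE
  have h1 : ∀ j : Fin (n + 1), ∫⁻ z, {z | ∀ i, LexLE (z i) (z j)}.indicator g z
      = ∫⁻ z, {z | ∀ i, LexLE (z i) (z 0)}.indicator g z := by
    intro j
    rw [← (measurePreserving_comp_perm (E := ℂ) (Equiv.swap 0 j)).lintegral_comp
      (hg.indicator (hmeas 0))]
    refine lintegral_congr fun z => ?_
    have hiff := (Equiv.swap 0 j).forall_congr_right (q := fun i => LexLE (z i) (z j))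
    classical
    rw [Set.indicator_apply, Set.indicator_apply, hs]
    simp only [Set.mem_ofPred_eq, Function.comp_apply, Equiv.swap_apply_left, hiff]
  have h2 : ∫⁻ z, g z = ∫⁻ z, ∑ j, {z | ∀ i, LexLE (z i) (z j)}.indicator g z := by
    apply lintegral_congr_ae
    -- Off the null set of coinciding coordinates, exactly one coordinate is the largest.
    filter_upwards [ae_injective (n + 1)] with z hz
    obtain ⟨i, hi⟩ := exists_forall_lexLE z
    rw [Finset.sum_eq_single i]
    · exact (Set.indicator_of_mem (s := {z : Fin (n + 1) → ℂ | ∀ k, LexLE (z k) (z i)}) (a := z) hi g).symm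
    · intro j _ hj
      refine Set.indicator_of_notMem (fun h => hj (hz ?_)) g
      exact (hi j).antisymm (h i)
    · simp
  rw [h2, lintegral_finsetSum _ fun j _ => hg.indicator (hmeas j)]
  simp [h1]


/-! ### Unitary reduction to a block triangular matrix -/

/-- Normalize `e` and complete it to an orthonormal basis, whose vectors are the rows of `V`. -/
theorem exists_unitary_row {n : ℕ} (e : Fin (n + 1) → ℂ) (he : e ≠ 0) :
    ∃ (V : Matrix (Fin (n + 1)) (Fin (n + 1)) ℂ) (r : ℂ), V * V.conjTranspose = 1 ∧
      V 0 = r • e := by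
  let u : EuclideanSpace ℂ (Fin (n + 1)) := WithLp.toLp 2 e
  have hu : u ≠ 0 := fun h => he (by
    have := congrArg WithLp.ofLp h
    exact this)
  let r : ℂ := ((‖u‖⁻¹ : ℝ) : ℂ)
  have hon : Orthonormal ℂ (({0} : Set (Fin (n + 1))).domRestrict fun _ => r • u) := by
    rw [orthonormal_iff_ite]
    rintro ⟨i, rfl⟩ ⟨j, rfl⟩
    have h1 : ‖r • u‖ = 1 := by
      rw [norm_smul]
      simp [r, hu]
    simp [Set.domRestrict_apply, inner_self_eq_norm_sq_to_K, h1]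
  obtain ⟨b, hb⟩ := hon.exists_orthonormalBasis_extension_of_card_eq (by simp)
  refine ⟨Matrix.of fun i j => b i j, r, ?_, ?_⟩
  · ext i k
    -- The indices are exchanged because the inner product is conjugate linear in its first
    -- argument.
    have := orthonormal_iff_ite.mp b.orthonormal k i
    rw [PiLp.inner_apply] at this
    rw [Matrix.mul_apply, Matrix.one_apply]
    simpa [eq_comm] using this
  · funext j
    have := congrArg (fun w : EuclideanSpace ℂ (Fin (n + 1)) => w j) (hb 0 rfl)
    exact this

/-- The last `n` rows of `V A V⁻¹`, where `A` has last rows `Y` and first row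
`-∑ vⱼ Yⱼ`. -/
def conjLastRows {n : ℕ} (V : Matrix (Fin (n + 1)) (Fin (n + 1)) ℂ) (v : Fin n → ℂ) :
    (Fin n → Fin (n + 1) → ℂ) →ₗ[ℝ] (Fin n → Fin (n + 1) → ℂ) where
  toFun Y j := (V * Matrix.of (Fin.cons (-∑ i, v i • Y i) Y : Fin (n + 1) → _)
    * V.conjTranspose) j.succ
  map_add' Y Z := by
    have : Matrix.of (Fin.cons (-∑ i, v i • (Y + Z) i) (Y + Z) : Fin (n + 1) → _)
        = Matrix.of (Fin.cons (-∑ i, v i • Y i) Y : Fin (n + 1) → _)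
          + Matrix.of (Fin.cons (-∑ i, v i • Z i) Z : Fin (n + 1) → _) := by
      ext j k
      refine Fin.cases ?_ (fun j => ?_) j
      · simp [Finset.sum_add_distrib]
        ring
      · simp
    ext j k
    rw [this, Matrix.mul_add, Matrix.add_mul]
    rfl
  map_smul' c Y := by
    have : Matrix.of (Fin.cons (-∑ i, v i • (c • Y) i) (c • Y) : Fin (n + 1) → _)
        = c • Matrix.of (Fin.cons (-∑ i, v i • Y i) Y : Fin (n + 1) → _) := by
      ext j k
      refine Fin.cases ?_ (fun j => ?_) j
      · simp [Finset.mul_sum, mul_left_comm]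
      · simp
    ext j k
    rw [this, Matrix.mul_smul, Matrix.smul_mul]
    rfl

/-- The first row is chosen so that `(1, v)` annihilates the matrix `A`. Hence row `0` of `V A`
vanishes, and if the other rows of `V A V*` vanish too then `A = 0`. -/
theorem injective_conjLastRows {n : ℕ} {V : Matrix (Fin (n + 1)) (Fin (n + 1)) ℂ}
    {v : Fin n → ℂ} {r : ℂ} (hV : V * V.conjTranspose = 1)
    (h0 : V 0 = r • (Fin.cons 1 v : Fin (n + 1) → ℂ)) :
    Function.Injective (conjLastRows V v) := by
  rw [injective_iff_map_eq_zero]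
  intro Y hY
  set A : Matrix (Fin (n + 1)) (Fin (n + 1)) ℂ :=
    Matrix.of (Fin.cons (-∑ i, v i • Y i) Y : Fin (n + 1) → _) with hA
  have hVA : (V * A) 0 = 0 := by
    change Matrix.vecMul (V 0) A = 0
    rw [h0, Matrix.smul_vecMul, hA, vecMul_of_eq_sum, Fin.sum_univ_succ]
    simp
  have hB : V * A * V.conjTranspose = 0 := by
    ext j k
    refine Fin.cases ?_ (fun j => ?_) j
    · rw [Matrix.mul_apply, hVA]
      simp
    · exact congrFun (congrFun hY j) k
  have hV' : V.conjTranspose * V = 1 := mul_eq_one_comm.mp hV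
  have hA0 : A = 0 := by
    calc A = V.conjTranspose * (V * A * V.conjTranspose) * V := by
          simp only [Matrix.mul_assoc, hV', Matrix.mul_one]
          rw [← Matrix.mul_assoc, hV', Matrix.one_mul]
      _ = 0 := by rw [hB]; simp
  ext j k
  exact congrFun (congrFun hA0 j.succ) k

/-- A function of matrices that is invariant under unitary conjugation has, on the matrices with
left eigenvector `(1, v)`, the same integral as on the block triangular matrices, up to a factor
that depends on `v` only. -/
theorem exists_lintegral_eigenRows {n : ℕ} (v : Fin n → ℂ) :
    ∃ c : ℝ≥0, ∀ (l : ℂ) (F : Matrix (Fin (n + 1)) (Fin (n + 1)) ℂ → ℝ≥0∞),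
      (∀ A V, V * V.conjTranspose = 1 → F (V * A * V.conjTranspose) = F A) →
      ∫⁻ Y, F (Matrix.of (eigenRows (Fin.cons l v) Y))
        = c * ∫⁻ Y : Fin n → Fin (n + 1) → ℂ,
          F (Matrix.of (Fin.cons (Pi.single 0 l) Y : Fin (n + 1) → _)) := by
  have he : (Fin.cons 1 v : Fin (n + 1) → ℂ) ≠ 0 := fun h => by
    have := congrFun h 0
    simp at this
  obtain ⟨V, r, hV, h0⟩ := exists_unitary_row _ he
  let L := LinearEquiv.ofInjectiveEndo _ (injective_conjLastRows hV h0)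
  obtain ⟨c, hc⟩ := exists_lintegral_eq_mul_lintegral_comp L.symm
  refine ⟨c, fun l F hF => ?_⟩
  -- The conjugated last rows are an affine function of `Y`. The eigenvalue `l` enters only through
  -- the translation `t`, which is why the constant does not depend on `l`.
  let t : Fin n → Fin (n + 1) → ℂ := fun j =>
    (V * Matrix.of (Fin.cons (l • Fin.cons 1 v) 0 : Fin (n + 1) → _) * V.conjTranspose) j.succ
  have key : ∀ Y, V * Matrix.of (eigenRows (Fin.cons l v) Y) * V.conjTranspose
      = Matrix.of (Fin.cons (Pi.single 0 l) (L Y + t) : Fin (n + 1) → _) := by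
    intro Y
    have h1 : Matrix.of (eigenRows (Fin.cons l v) Y)
        = Matrix.of (Fin.cons (-∑ i, v i • Y i) Y : Fin (n + 1) → _)
          + Matrix.of (Fin.cons (l • Fin.cons 1 v) 0 : Fin (n + 1) → _) := by
      ext j k
      refine Fin.cases ?_ (fun j => ?_) j
      · simp [eigenRows, eigenRow, eigenvectorOf]
        ring
      · simp [eigenRows]
    have h2 : (V * Matrix.of (eigenRows (Fin.cons l v) Y)) 0 = l • V 0 := by
      change Matrix.vecMul (V 0) _ = _
      have := vecMul_eigenRows (Fin.cons l v) Y
      simp only [eigenvectorOf, Fin.tail_cons, Fin.cons_zero] at this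
      rw [h0, Matrix.smul_vecMul, this, smul_comm]
    ext j k
    refine Fin.cases ?_ (fun j => ?_) j
    · have h3 := congrFun (congrFun hV 0) k
      rw [Matrix.mul_apply] at h3 ⊢
      simp only [h2, Pi.smul_apply, smul_eq_mul, mul_assoc, ← Finset.mul_sum, h3]
      simp [Matrix.one_apply, Pi.single_apply, eq_comm]
    · rw [h1, Matrix.mul_add, Matrix.add_mul]
      rfl
  calc ∫⁻ Y, F (Matrix.of (eigenRows (Fin.cons l v) Y))
      = ∫⁻ Y, F (Matrix.of (Fin.cons (Pi.single 0 l) (L Y + t) : Fin (n + 1) → _)) := by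
        simp_rw [← key, hF _ V hV]
    _ = c * ∫⁻ Y : Fin n → Fin (n + 1) → ℂ,
          F (Matrix.of (Fin.cons (Pi.single 0 l) (Y + t) : Fin (n + 1) → _)) := by
        rw [hc]
        simp
    _ = _ := by
        congr 1
        exact lintegral_add_right_eq_self (μ := volume)
          (fun Y => F (Matrix.of (Fin.cons (Pi.single 0 l) Y : Fin (n + 1) → _))) t

/-- The Gaussian weight `exp (-‖c‖²)` of a family of rows. -/
noncomputable def gaussianWeight {ι κ : Type*} [Fintype ι] [Fintype κ] (c : ι → κ → ℂ) : ℝ≥0∞ :=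
  ENNReal.ofReal (Real.exp (-∑ j, ∑ i, ‖c j i‖ ^ 2))

theorem measurable_gaussianWeight {ι κ : Type*} [Fintype ι] [Fintype κ] :
    Measurable (gaussianWeight : (ι → κ → ℂ) → ℝ≥0∞) := by
  unfold gaussianWeight
  fun_prop

/-- The exponent is minus the trace of `A A*`, which is unitarily invariant. -/
theorem gaussianWeight_conj {m : ℕ} {A V : Matrix (Fin m) (Fin m) ℂ}
    (hV : V * V.conjTranspose = 1) :
    gaussianWeight (V * A * V.conjTranspose) = gaussianWeight A := by
  have h : ∀ B : Matrix (Fin m) (Fin m) ℂ,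
      ∑ j, ∑ i, ‖B j i‖ ^ 2 = (Matrix.trace (B * B.conjTranspose)).re := by
    intro B
    simp only [Matrix.trace, Matrix.diag, Matrix.mul_apply, Complex.re_sum,
      Matrix.conjTranspose_apply]
    refine Finset.sum_congr rfl fun j _ => Finset.sum_congr rfl fun i _ => ?_
    rw [Complex.star_def, Complex.mul_conj, Complex.ofReal_re, Complex.normSq_eq_norm_sq]
  have hV' : V.conjTranspose * V = 1 := mul_eq_one_comm.mp hV
  unfold gaussianWeight
  rw [h, h]
  have hE : V * A * V.conjTranspose * (V * A * V.conjTranspose).conjTranspose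
      = V * (A * A.conjTranspose) * V.conjTranspose := by
    simp only [Matrix.conjTranspose_mul, Matrix.conjTranspose_conjTranspose, Matrix.mul_assoc]
    rw [← Matrix.mul_assoc V.conjTranspose V, hV', Matrix.one_mul]
  rw [hE, Matrix.trace_mul_cycle, ← Matrix.mul_assoc, hV', Matrix.one_mul]

theorem charpoly_conj {m : ℕ} {A V : Matrix (Fin m) (Fin m) ℂ}
    (hV : V * V.conjTranspose = 1) : (V * A * V.conjTranspose).charpoly = A.charpoly := by
  have hV' : V.conjTranspose * V = 1 := mul_eq_one_comm.mp hV
  have h := Matrix.charpoly_units_conj ⟨V, V.conjTranspose, hV, hV'⟩ A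
  rwa [Units.val_mk, Matrix.inv_eq_right_inv hV] at h


/-! ### The law of the eigenvalues up to a constant -/

/-- Expand `det (z - A)` along the first row, whose only nonzero entry can be `z - l`. -/
theorem isEigenvalueList_blockTriangular {n : ℕ} (l : ℂ) (b : Fin n → ℂ) (D : Fin n → Fin n → ℂ)
    {w : Fin n → ℂ} (hw : IsEigenvalueList (Matrix.of D) w) :
    IsEigenvalueList
      (Matrix.of (Fin.cons (Pi.single 0 l) (consColumn n (b, D)) : Fin (n + 1) → _))
      (Fin.cons l w) := by
  apply isEigenvalueList_of_charpoly_eq_prod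
  apply Polynomial.funext
  intro z
  rw [Matrix.eval_charpoly, Matrix.det_succ_row_zero, Finset.sum_eq_single 0, Polynomial.eval_prod,
    Fin.prod_univ_succ]
  · have h1 : (Matrix.scalar (Fin (n + 1)) z
        - Matrix.of (Fin.cons (Pi.single 0 l) (consColumn n (b, D)) : Fin (n + 1) → _)).submatrix
          Fin.succ (Fin.succAbove 0) = Matrix.scalar (Fin n) z - Matrix.of D := by
      ext i j
      simp [consColumn, Matrix.diagonal_apply]
    rw [h1, det_sub_eq_prod_of_isEigenvalueList hw]
    simp
  · intro j _ hj
    simp [hj, hj.symm]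
  · simp

theorem eval_derivative_charpoly_of_isEigenvalueList {n : ℕ}
    {A : Matrix (Fin (n + 1)) (Fin (n + 1)) ℂ} {l : ℂ} {w : Fin n → ℂ}
    (h : IsEigenvalueList A (Fin.cons l w)) :
    A.charpoly.derivative.eval l = ∏ i, (l - w i) := by
  rw [charpoly_eq_prod_of_isEigenvalueList h, Fin.prod_univ_succ]
  simp [Polynomial.derivative_mul, Polynomial.eval_prod]

/-- The restriction of `f` to the vectors that are bounded by `l` in lexicographic order. -/
noncomputable def restrictLE {N : ℕ} (f : (Fin N → ℂ) → ℝ≥0∞) (l : ℂ) (z : Fin N → ℂ) : ℝ≥0∞ :=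
  {z : Fin N → ℂ | ∀ i, LexLE (z i) l}.indicator f z

theorem measurableSet_forall_lexLE (N : ℕ) :
    MeasurableSet {p : ℂ × (Fin N → ℂ) | ∀ i, LexLE (p.2 i) p.1} := by
  simp only [Set.ofPred_forall]
  refine MeasurableSet.iInter fun i => ?_
  have hp : Measurable fun p : ℂ × (Fin N → ℂ) => (p.2 i, p.1) := by fun_prop
  exact hp measurableSet_lexLE

theorem measurable_restrictLE {N : ℕ} {f : (Fin N → ℂ) → ℝ≥0∞} (hf : Measurable f) :
    Measurable fun p : ℂ × (Fin N → ℂ) => restrictLE f p.1 p.2 :=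
  (hf.comp measurable_snd).indicator (measurableSet_forall_lexLE N)

theorem restrictLE_comp_perm {N : ℕ} {f : (Fin N → ℂ) → ℝ≥0∞}
    (hs : ∀ z (σ : Equiv.Perm (Fin N)), f (z ∘ σ) = f z) (l : ℂ) (z : Fin N → ℂ)
    (σ : Equiv.Perm (Fin N)) : restrictLE f l (z ∘ σ) = restrictLE f l z := by
  classical
  have h := σ.forall_congr_right (q := fun i => LexLE (z i) l)
  unfold restrictLE
  rw [Set.indicator_apply, Set.indicator_apply, hs]
  simp only [Set.mem_ofPred_eq, Function.comp_apply, h]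

theorem gaussianWeight_eq_prod {ι κ : Type*} [Fintype ι] [Fintype κ] (c : ι → κ → ℂ) :
    gaussianWeight c = ∏ j, ∏ i, ENNReal.ofReal (Real.exp (-‖c j i‖ ^ 2)) := by
  unfold gaussianWeight
  rw [← Finset.sum_neg_distrib, Real.exp_sum, ENNReal.ofReal_prod_of_nonneg
    fun _ _ => (Real.exp_pos _).le]
  refine Finset.prod_congr rfl fun j _ => ?_
  rw [← Finset.sum_neg_distrib, Real.exp_sum, ENNReal.ofReal_prod_of_nonneg
    fun _ _ => (Real.exp_pos _).le]

theorem integrable_norm_pow_mul_exp (l : ℕ) :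
    Integrable (fun z : ℂ => ‖z‖ ^ (2 * l) * Real.exp (-‖z‖ ^ 2)) ∧
      ∫ z : ℂ, ‖z‖ ^ (2 * l) * Real.exp (-‖z‖ ^ 2) = Real.pi * l ! := by
  have h := Complex.integral_rpow_mul_exp_neg_rpow (p := 2) (q := ((2 * l : ℕ) : ℝ)) (by norm_num)
    (by
      have : (0 : ℝ) ≤ ((2 * l : ℕ) : ℝ) := by positivity
      linarith)
  have h1 : (((2 * l : ℕ) : ℝ) + 2) / 2 = l + 1 := by
    push_cast
    ring
  rw [h1, Real.Gamma_nat_eq_factorial] at h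
  simp_rw [Real.rpow_natCast, Real.rpow_ofNat] at h
  have h2 : 2 * Real.pi / 2 * (l ! : ℝ) = Real.pi * l ! := by ring
  rw [h2] at h
  refine ⟨?_, h⟩
  -- A non-integrable function has integral `0` by convention, whereas the value found is positive.
  by_contra hi
  rw [integral_undef hi] at h
  exact (mul_pos Real.pi_pos (by positivity : (0 : ℝ) < l !)).ne h

theorem lintegral_exp_neg_norm_sq :
    ∫⁻ z : ℂ, ENNReal.ofReal (Real.exp (-‖z‖ ^ 2)) = ENNReal.ofReal Real.pi := by
  have h := integrable_norm_pow_mul_exp 0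
  simp only [mul_zero, pow_zero, one_mul, Nat.factorial_zero, Nat.cast_one, mul_one] at h
  rw [← ofReal_integral_eq_lintegral_ofReal h.1, h.2]
  exact Filter.Eventually.of_forall fun _ => (Real.exp_pos _).le

theorem lintegral_prod_fin {E : Type*} [MeasureSpace E] [SigmaFinite (volume : Measure E)] {n : ℕ}
    {f : Fin n → E → ℝ≥0∞} (hf : ∀ i, Measurable (f i)) :
    ∫⁻ c : Fin n → E, ∏ i, f i (c i) = ∏ i, ∫⁻ x, f i x := by
  induction n with
  | zero => simp [volume_pi]
  | succ n ih =>
    rw [lintegral_fin_cons (by fun_prop), Fin.prod_univ_succ, ← ih fun i => hf i.succ,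
      ← lintegral_mul_const _ (hf 0)]
    refine lintegral_congr fun x => ?_
    rw [← lintegral_const_mul _ (by fun_prop)]
    simp [Fin.prod_univ_succ]

theorem lintegral_gaussianWeight {m n : ℕ} :
    ∫⁻ c : Fin m → Fin n → ℂ, gaussianWeight c = (ENNReal.ofReal Real.pi ^ n) ^ m := by
  simp_rw [gaussianWeight_eq_prod]
  rw [lintegral_prod_fin (f := fun _ (r : Fin n → ℂ) => ∏ i, ENNReal.ofReal (Real.exp (-‖r i‖ ^ 2)))
    fun _ => by fun_prop]
  simp_rw [lintegral_prod_fin (n := n)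
    (f := fun _ (r : ℂ) => ENNReal.ofReal (Real.exp (-‖r‖ ^ 2))) fun _ => by fun_prop]
  simp [lintegral_exp_neg_norm_sq]

/-- The joint density of the top eigenvalue and the matrix, in the coordinates of
`eigenRows`. -/
noncomputable def topIntegrand {n : ℕ} (f : (Fin (n + 1) → ℂ) → ℝ≥0∞) (l : ℂ)
    (A : Matrix (Fin (n + 1)) (Fin (n + 1)) ℂ) : ℝ≥0∞ :=
  ENNReal.ofReal (‖A.charpoly.derivative.eval l‖ ^ 2) *
    (gaussianWeight A * restrictLE f l (someEigenvalueList A))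

theorem continuous_eigenRows {n : ℕ} :
    Continuous fun p : (Fin (n + 1) → ℂ) × (Fin n → Fin (n + 1) → ℂ) => eigenRows p.1 p.2 := by
  have he : ∀ k, Continuous fun x : Fin (n + 1) → ℂ => eigenvectorOf x k := by
    intro k
    refine Fin.cases ?_ (fun k => ?_) k
    · exact continuous_const
    · exact continuous_apply k.succ
  refine continuous_pi fun j => continuous_pi fun k => ?_
  refine Fin.cases ?_ (fun j => ?_) j
  · have h1 : Continuous fun p : (Fin (n + 1) → ℂ) × (Fin n → Fin (n + 1) → ℂ) =>
        eigenvectorOf p.1 k := (he k).comp continuous_fst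
    simp only [eigenRows, Fin.cons_zero, eigenRow, Pi.sub_apply, Pi.smul_apply, Finset.sum_apply,
      smul_eq_mul]
    fun_prop
  · exact (continuous_apply_apply j k).comp continuous_snd

theorem measurableSet_topEigenvalueSet {n : ℕ} :
    MeasurableSet {p : (Fin n → Fin (n + 1) → ℂ) × (Fin (n + 1) → ℂ) |
      p.2 ∈ topEigenvalueSet p.1} := by
  have h0 : Measurable fun p : ℂ × (Fin (n + 1) → ℂ) => ∀ i, LexLE (p.2 i) p.1 :=
    measurableSet_setOfPred.mp (measurableSet_forall_lexLE (n + 1))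
  have h1 : MeasurableSet {p : ℂ × (Fin (n + 1) → Fin (n + 1) → ℂ) |
      ∀ i, LexLE (someEigenvalueList (Matrix.of p.2) i) p.1} :=
    measurableSet_setOfPred.mpr (measurable_symmetric_eigenvalues h0
      fun a z σ => propext (σ.forall_congr_right (q := fun i => LexLE (z i) a)))
  have h2 : Measurable fun p : (Fin n → Fin (n + 1) → ℂ) × (Fin (n + 1) → ℂ) => p.2 0 :=
    (measurable_pi_apply 0).comp measurable_snd
  have h3 : Measurable fun p : (Fin n → Fin (n + 1) → ℂ) × (Fin (n + 1) → ℂ) =>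
      eigenRows p.2 p.1 := (continuous_eigenRows.comp continuous_swap).measurable
  exact (h2.prodMk h3) h1

theorem measurable_topIntegrand {n : ℕ} {f : (Fin (n + 1) → ℂ) → ℝ≥0∞} (hf : Measurable f)
    (hs : ∀ z (σ : Equiv.Perm (Fin (n + 1))), f (z ∘ σ) = f z) :
    Measurable fun p : (Fin (n + 1) → ℂ) × (Fin n → Fin (n + 1) → ℂ) =>
      topIntegrand f (p.1 0) (Matrix.of (eigenRows p.1 p.2)) := by
  have hm : Measurable fun p : (Fin (n + 1) → ℂ) × (Fin n → Fin (n + 1) → ℂ) =>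
      (p.1 0, eigenRows p.1 p.2) :=
    (by fun_prop : Measurable fun p : (Fin (n + 1) → ℂ) × (Fin n → Fin (n + 1) → ℂ) =>
      p.1 0).prodMk continuous_eigenRows.measurable
  have h1 := (measurable_symmetric_eigenvalues (α := ℂ) (measurable_restrictLE hf)
    fun a z σ => restrictLE_comp_perm hs a z σ).comp hm
  have h2 : Measurable fun p : (Fin (n + 1) → ℂ) × (Fin n → Fin (n + 1) → ℂ) =>
      gaussianWeight (eigenRows p.1 p.2) :=
    measurable_gaussianWeight.comp continuous_eigenRows.measurable
  have he : Continuous fun x : Fin (n + 1) → ℂ => eigenvectorOf x := by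
    refine continuous_pi fun k => ?_
    refine Fin.cases ?_ (fun k => ?_) k
    · exact continuous_const
    · exact continuous_apply k.succ
  have h3 : Continuous fun p : (Fin (n + 1) → ℂ) × (Fin n → Fin (n + 1) → ℂ) =>
      (eigenRowJacobian p.2 p.1).det := by
    apply Continuous.matrix_det
    refine Continuous.matrix_updateRow 0 (Continuous.sub ?_ continuous_eigenRows)
      (he.comp continuous_fst)
    exact Continuous.matrix_diagonal (continuous_pi fun _ =>
      (continuous_apply 0).comp continuous_fst)
  have h4 : ∀ p : (Fin (n + 1) → ℂ) × (Fin n → Fin (n + 1) → ℂ),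
      (Matrix.of (eigenRows p.1 p.2)).charpoly.derivative.eval (p.1 0)
        = (eigenRowJacobian p.2 p.1).det := fun p =>
    eval_derivative_charpoly_of_vecMul (by simp [eigenvectorOf]) (vecMul_eigenRows p.1 p.2)
  unfold topIntegrand
  simp_rw [h4]
  exact (h3.measurable.norm.pow_const 2).ennreal_ofReal.mul (h2.mul h1)

/-- Every factor depends only on the characteristic polynomial or on the Gaussian weight. -/
theorem topIntegrand_conj {n : ℕ} {f : (Fin (n + 1) → ℂ) → ℝ≥0∞}
    (hs : ∀ z (σ : Equiv.Perm (Fin (n + 1))), f (z ∘ σ) = f z) (l : ℂ)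
    (A V : Matrix (Fin (n + 1)) (Fin (n + 1)) ℂ) (hV : V * V.conjTranspose = 1) :
    topIntegrand f l (V * A * V.conjTranspose) = topIntegrand f l A := by
  have h1 : IsEigenvalueList A (someEigenvalueList (V * A * V.conjTranspose)) := by
    have := someEigenvalueList_spec (V * A * V.conjTranspose)
    unfold IsEigenvalueList at this ⊢
    rwa [charpoly_conj hV] at this
  obtain ⟨σ, hσ⟩ := h1.exists_perm (someEigenvalueList_spec A)
  unfold topIntegrand
  rw [charpoly_conj hV, gaussianWeight_conj hV, hσ, restrictLE_comp_perm hs]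


/-- The law of the eigenvalues of a Gaussian matrix has, up to a constant factor, density
`ginibreDensity N`. -/
def HasGinibreEigenvalueLaw (N : ℕ) : Prop :=
  ∃ C : ℝ≥0∞, ∀ f : (Fin N → ℂ) → ℝ≥0∞, Measurable f →
    (∀ z (σ : Equiv.Perm (Fin N)), f (z ∘ σ) = f z) →
    ∫⁻ c : Fin N → Fin N → ℂ, gaussianWeight c * f (someEigenvalueList (Matrix.of c))
      = C * ∫⁻ z, ENNReal.ofReal (ginibreDensity N z) * f z

theorem measurable_symmetric_eigenvalues' {β : Type*} [MeasurableSpace β] {N : ℕ}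
    {f : (Fin N → ℂ) → β} (hf : Measurable f)
    (hs : ∀ z (σ : Equiv.Perm (Fin N)), f (z ∘ σ) = f z) :
    Measurable fun c : Fin N → Fin N → ℂ => f (someEigenvalueList (Matrix.of c)) := by
  have h1 : Measurable fun p : Unit × (Fin N → ℂ) => f p.2 := hf.comp measurable_snd
  have h2 := measurable_symmetric_eigenvalues h1 fun _ z σ => hs z σ
  have h3 : Measurable fun c : Fin N → Fin N → ℂ => ((), c) :=
    measurable_const.prodMk measurable_id
  exact (h2.comp h3 :)

theorem measurableSet_injective (N : ℕ) :
    MeasurableSet {z : Fin N → ℂ | Function.Injective z} := by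
  have : {z : Fin N → ℂ | Function.Injective z}
      = ⋂ i, ⋂ j, {z : Fin N → ℂ | z i = z j → i = j} := by
    ext z
    simp [Function.Injective]
  rw [this]
  refine MeasurableSet.iInter fun i => MeasurableSet.iInter fun j => ?_
  by_cases hij : i = j
  · simp [hij]
  · have : {z : Fin N → ℂ | z i = z j → i = j} = {z : Fin N → ℂ | z i = z j}ᶜ := by
      ext z
      simp [hij]
    rw [this]
    exact (measurableSet_eq_fun (measurable_pi_apply i) (measurable_pi_apply j)).compl

theorem gaussianWeight_ne_zero {ι κ : Type*} [Fintype ι] [Fintype κ] (c : ι → κ → ℂ) :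
    gaussianWeight c ≠ 0 := by
  unfold gaussianWeight
  rw [Ne, ENNReal.ofReal_eq_zero, not_le]
  exact Real.exp_pos _

/-- Test the law on the indicator of vectors with a repeated coordinate. The right side is zero even
if the constant is infinite, and the Gaussian weight never vanishes. -/
theorem HasGinibreEigenvalueLaw.ae_injective {N : ℕ} (h : HasGinibreEigenvalueLaw N) :
    ∀ᵐ c : Fin N → Fin N → ℂ, Function.Injective (someEigenvalueList (Matrix.of c)) := by
  classical
  obtain ⟨C, hC⟩ := h
  let f : (Fin N → ℂ) → ℝ≥0∞ := {z | Function.Injective z}ᶜ.indicator 1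
  have hf : Measurable f := measurable_one.indicator (measurableSet_injective N).compl
  have hs : ∀ z (σ : Equiv.Perm (Fin N)), f (z ∘ σ) = f z := by
    intro z σ
    simp only [f, Set.indicator_apply, Set.mem_compl_iff, Set.mem_ofPred_eq,
      σ.injective_comp]
    rfl
  have h1 := hC f hf hs
  have h2 : ∫⁻ z, ENNReal.ofReal (ginibreDensity N z) * f z = 0 := by
    rw [← lintegral_zero]
    apply lintegral_congr_ae
    filter_upwards [_root_.ae_injective N] with z hz
    simp [f, hz]
  have hm : Measurable fun c : Fin N → Fin N → ℂ =>
      gaussianWeight c * f (someEigenvalueList (Matrix.of c)) :=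
    measurable_gaussianWeight.mul (measurable_symmetric_eigenvalues' hf hs)
  rw [h2, mul_zero, lintegral_eq_zero_iff hm] at h1
  filter_upwards [h1] with c hc
  have := (mul_eq_zero.mp hc).resolve_left (gaussianWeight_ne_zero c)
  by_contra hinj
  simp [f, hinj] at this

theorem gaussianWeight_blockTriangular {n : ℕ} (l : ℂ) (b : Fin n → ℂ) (D : Fin n → Fin n → ℂ) :
    gaussianWeight (Fin.cons (Pi.single 0 l) (consColumn n (b, D)) : Fin (n + 1) → _)
      = ENNReal.ofReal (Real.exp (-‖l‖ ^ 2)) *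
        ((∏ j, ENNReal.ofReal (Real.exp (-‖b j‖ ^ 2))) * gaussianWeight D) := by
  simp_rw [gaussianWeight_eq_prod, Fin.prod_univ_succ, Finset.prod_mul_distrib.symm]
  simp [consColumn, Finset.prod_mul_distrib]

/-- The Gaussian weight factors over `l`, the column `b` and the block `D`. The column integrates to
a constant, and the law in dimension `n` applies to `D`. -/
theorem lintegral_topIntegrand_blockTriangular {n : ℕ} {C : ℝ≥0∞}
    (hC : ∀ f : (Fin n → ℂ) → ℝ≥0∞, Measurable f →
      (∀ z (σ : Equiv.Perm (Fin n)), f (z ∘ σ) = f z) →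
      ∫⁻ c : Fin n → Fin n → ℂ, gaussianWeight c * f (someEigenvalueList (Matrix.of c))
        = C * ∫⁻ z, ENNReal.ofReal (ginibreDensity n z) * f z) :
    ∃ C' : ℝ≥0∞, ∀ f : (Fin (n + 1) → ℂ) → ℝ≥0∞, Measurable f →
      (∀ z (σ : Equiv.Perm (Fin (n + 1))), f (z ∘ σ) = f z) → ∀ l,
      ∫⁻ Y : Fin n → Fin (n + 1) → ℂ,
        topIntegrand f l (Matrix.of (Fin.cons (Pi.single 0 l) Y : Fin (n + 1) → _))
        = C' * ∫⁻ z : Fin n → ℂ, ENNReal.ofReal (ginibreDensity (n + 1) (Fin.cons l z))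
          * restrictLE f l (Fin.cons l z) := by
  obtain ⟨c, hc⟩ := exists_lintegral_eq_mul_lintegral_comp (consColumn n)
  let B : ℝ≥0∞ := ∫⁻ b : Fin n → ℂ, ∏ j, ENNReal.ofReal (Real.exp (-‖b j‖ ^ 2))
  -- The factor `π (n + 1)!` compensates the normalizations of `ginibreWeight l` and of the density
  -- in dimension `n + 1`.
  refine ⟨c * (B * (C * ENNReal.ofReal (Real.pi * (n + 1)!))), fun f hf hs l => ?_⟩
  -- The test function for `D`: its product is `|χ'(l)|²` for the block triangular matrix.
  let F : (Fin n → ℂ) → ℝ≥0∞ := fun z =>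
    ENNReal.ofReal (∏ i, ‖l - z i‖ ^ 2) * restrictLE f l (Fin.cons l z)
  have hcons : Measurable fun z : Fin n → ℂ => (Fin.cons l z : Fin (n + 1) → ℂ) :=
    measurable_fin_cons.comp (measurable_const.prodMk measurable_id)
  have hR : Measurable fun z : Fin n → ℂ => restrictLE f l (Fin.cons l z) :=
    (measurable_restrictLE hf).comp (measurable_const.prodMk hcons)
  have hF : Measurable F := by fun_prop
  have hFs : ∀ z (σ : Equiv.Perm (Fin n)), F (z ∘ σ) = F z := by
    intro z σ
    simp only [F]
    congr 1
    · congr 1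
      exact Equiv.prod_comp σ fun i => ‖l - z i‖ ^ 2
    · have : (Fin.cons l (z ∘ σ) : Fin (n + 1) → ℂ)
          = (Fin.cons l z : Fin (n + 1) → ℂ) ∘ (Equiv.Perm.decomposeFin.symm (0, σ)) := by
        ext k
        refine Fin.cases ?_ (fun k => ?_) k <;> simp [Equiv.Perm.decomposeFin_symm_apply_succ]
      rw [this, restrictLE_comp_perm hs]
  have hint : ∀ p : (Fin n → ℂ) × (Fin n → Fin n → ℂ),
      topIntegrand f l (Matrix.of (Fin.cons (Pi.single 0 l) (consColumn n p) : Fin (n + 1) → _))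
        = ENNReal.ofReal (Real.exp (-‖l‖ ^ 2)) *
          ((∏ j, ENNReal.ofReal (Real.exp (-‖p.1 j‖ ^ 2))) *
            (gaussianWeight p.2 * F (someEigenvalueList (Matrix.of p.2)))) := by
    rintro ⟨b, D⟩
    have hE := isEigenvalueList_blockTriangular l b D (someEigenvalueList_spec (Matrix.of D))
    obtain ⟨σ, hσ⟩ := (someEigenvalueList_spec _).exists_perm hE
    unfold topIntegrand
    rw [hσ, restrictLE_comp_perm hs, eval_derivative_charpoly_of_isEigenvalueList hE]
    have := gaussianWeight_blockTriangular l b D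
    have h2 : gaussianWeight (Matrix.of (Fin.cons (Pi.single 0 l) (consColumn n (b, D)) :
      Fin (n + 1) → _)) = _ := this
    rw [h2]
    simp only [F, norm_prod, Finset.prod_pow]
    ring
  have hFm : Measurable fun D : Fin n → Fin n → ℂ =>
      gaussianWeight D * F (someEigenvalueList (Matrix.of D)) :=
    measurable_gaussianWeight.mul (measurable_symmetric_eigenvalues' hF hFs)
  rw [hc, mul_assoc]
  congr 1
  simp_rw [hint]
  have hBm : Measurable fun b : Fin n → ℂ => ∏ j, ENNReal.ofReal (Real.exp (-‖b j‖ ^ 2)) := by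
    fun_prop
  have hBF : Measurable fun p : (Fin n → ℂ) × (Fin n → Fin n → ℂ) =>
      (∏ j, ENNReal.ofReal (Real.exp (-‖p.1 j‖ ^ 2))) *
        (gaussianWeight p.2 * F (someEigenvalueList (Matrix.of p.2))) :=
    ((hBm.comp measurable_fst).mul (hFm.comp measurable_snd) :)
  rw [lintegral_const_mul _ hBF,
    Measure.volume_eq_prod, lintegral_prod_mul hBm.aemeasurable hFm.aemeasurable, hC F hF hFs]
  have hlast : ∀ z : Fin n → ℂ, ENNReal.ofReal (Real.pi * (n + 1)!) *
      (ENNReal.ofReal (ginibreDensity (n + 1) (Fin.cons l z)) * restrictLE f l (Fin.cons l z))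
      = ENNReal.ofReal (Real.exp (-‖l‖ ^ 2)) * (ENNReal.ofReal (ginibreDensity n z) * F z) := by
    intro z
    simp only [F]
    rw [← mul_assoc, ← mul_assoc, ← mul_assoc, ← ENNReal.ofReal_mul (by positivity),
      ← ENNReal.ofReal_mul (by positivity),
      ← ENNReal.ofReal_mul (mul_nonneg (Real.exp_pos _).le (ginibreDensity_nonneg _ _)),
      ginibreDensity_cons]
    congr 2
    have h2 : ((n + 1)! : ℝ) ≠ 0 := by positivity
    have h3 := Real.pi_ne_zero
    unfold ginibreWeight
    simp only [mul_one]
    field_simp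
  have hG : Measurable fun z : Fin n → ℂ =>
      ENNReal.ofReal (ginibreDensity (n + 1) (Fin.cons l z)) * restrictLE f l (Fin.cons l z) :=
    ((measurable_ginibreDensity _).comp hcons).ennreal_ofReal.mul hR
  have hG' : Measurable fun z : Fin n → ℂ => ENNReal.ofReal (ginibreDensity n z) * F z :=
    (measurable_ginibreDensity _).ennreal_ofReal.mul hF
  have h5 : ENNReal.ofReal (Real.pi * (n + 1)!) * ∫⁻ z : Fin n → ℂ,
      ENNReal.ofReal (ginibreDensity (n + 1) (Fin.cons l z)) * restrictLE f l (Fin.cons l z)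
      = ENNReal.ofReal (Real.exp (-‖l‖ ^ 2)) *
        ∫⁻ z, ENNReal.ofReal (ginibreDensity n z) * F z := by
    rw [← lintegral_const_mul _ hG, ← lintegral_const_mul _ hG']
    exact lintegral_congr hlast
  rw [mul_assoc, mul_assoc, h5]
  ring

/-- Testing on the Gaussian weight with `l = 0` expresses the factor as an integral depending
measurably on `v`, divided by the positive finite constant `J`. -/
theorem exists_lintegral_eigenRows_measurable (n : ℕ) :
    ∃ c : (Fin n → ℂ) → ℝ≥0∞, Measurable c ∧
      ∀ v l (F : Matrix (Fin (n + 1)) (Fin (n + 1)) ℂ → ℝ≥0∞),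
      (∀ A V, V * V.conjTranspose = 1 → F (V * A * V.conjTranspose) = F A) →
      ∫⁻ Y, F (Matrix.of (eigenRows (Fin.cons l v) Y))
        = c v * ∫⁻ Y : Fin n → Fin (n + 1) → ℂ,
          F (Matrix.of (Fin.cons (Pi.single 0 l) Y : Fin (n + 1) → _)) := by
  choose c hc using exists_lintegral_eigenRows (n := n)
  refine ⟨fun v => c v, ?_, hc⟩
  let J : ℝ≥0∞ := (ENNReal.ofReal Real.pi ^ (n + 1)) ^ n
  have hJ0 : J ≠ 0 := by
    simp [J, Real.pi_pos]
  have hJt : J ≠ ∞ := by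
    simp [J]
  have h1 : ∀ v, (c v : ℝ≥0∞)
      = (∫⁻ Y, gaussianWeight (eigenRows (Fin.cons 0 v) Y)) / J := by
    intro v
    have h2 := hc v 0 gaussianWeight fun A V hV => gaussianWeight_conj hV
    have h3 : ∀ Y : Fin n → Fin (n + 1) → ℂ, gaussianWeight
        (Matrix.of (Fin.cons (Pi.single 0 0) Y : Fin (n + 1) → Fin (n + 1) → ℂ))
        = gaussianWeight Y := by
      intro Y
      change gaussianWeight (Fin.cons (Pi.single 0 0) Y : Fin (n + 1) → Fin (n + 1) → ℂ) = _
      rw [gaussianWeight_eq_prod, gaussianWeight_eq_prod, Fin.prod_univ_succ]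
      simp
    simp_rw [h3, lintegral_gaussianWeight] at h2
    rw [ENNReal.eq_div_iff hJ0 hJt, mul_comm]
    exact h2.symm
  simp_rw [h1]
  have h4 : Measurable fun p : (Fin n → ℂ) × (Fin n → Fin (n + 1) → ℂ) =>
      gaussianWeight (eigenRows (Fin.cons 0 p.1) p.2) := by
    have h5 : Measurable fun p : (Fin n → ℂ) × (Fin n → Fin (n + 1) → ℂ) => ((0 : ℂ), p.1) :=
      measurable_const.prodMk measurable_fst
    have h6 : Measurable fun p : (Fin n → ℂ) × (Fin n → Fin (n + 1) → ℂ) =>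
        (Fin.cons 0 p.1 : Fin (n + 1) → ℂ) := (measurable_fin_cons.comp h5 :)
    have h7 : Measurable fun p : (Fin n → ℂ) × (Fin n → Fin (n + 1) → ℂ) =>
        eigenRows (Fin.cons 0 p.1) p.2 :=
      (continuous_eigenRows.measurable.comp (h6.prodMk measurable_snd) :)
    exact (measurable_gaussianWeight.comp h7 :)
  exact h4.lintegral_prod_right'.div_const J

/-- After the first row is exchanged for `(l, v)`, the integral over `Y` is taken first. Then `v`
appears only in `c v` and integrates to a constant, while restricting to the top eigenvalue accounts
for the factor `(n + 1)⁻¹`. -/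
theorem hasGinibreEigenvalueLaw_succ {n : ℕ} (h : HasGinibreEigenvalueLaw n) :
    HasGinibreEigenvalueLaw (n + 1) := by
  have hQ := ae_noSingularEigenvector h.ae_injective
  obtain ⟨C, hC⟩ := h
  obtain ⟨C', hC'⟩ := lintegral_topIntegrand_blockTriangular hC
  obtain ⟨c, hcm, hc⟩ := exists_lintegral_eigenRows_measurable n
  -- This constant is not shown to be finite here; the normalization in
  -- `IsComplexGinibre.lintegral_symmetric` makes that unnecessary.
  refine ⟨(∫⁻ v, c v) * C' * ((n : ℝ≥0∞) + 1)⁻¹, fun f hf hs => ?_⟩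
  have hG : Measurable fun r : Fin (n + 1) → Fin (n + 1) → ℂ =>
      gaussianWeight r * f (someEigenvalueList (Matrix.of r)) :=
    measurable_gaussianWeight.mul (measurable_symmetric_eigenvalues' hf hs)
  have hT := measurable_topIntegrand hf hs
  have hρ : Measurable fun z : Fin (n + 1) → ℂ =>
      ENNReal.ofReal (ginibreDensity (n + 1) z) * f z :=
    (measurable_ginibreDensity _).ennreal_ofReal.mul hf
  have hr : Measurable fun z : Fin (n + 1) → ℂ => restrictLE f (z 0) z := by
    have h0 : Measurable fun z : Fin (n + 1) → ℂ => (z 0, z) :=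
      (measurable_pi_apply 0).prodMk measurable_id
    exact ((measurable_restrictLE hf).comp h0 :)
  have hρ' : Measurable fun z : Fin (n + 1) → ℂ =>
      ENNReal.ofReal (ginibreDensity (n + 1) z) * restrictLE f (z 0) z :=
    (measurable_ginibreDensity _).ennreal_ofReal.mul hr
  have hcv : ∀ Y : Fin n → Fin (n + 1) → ℂ, NoSingularEigenvector Y →
      ∫⁻ r : Fin (n + 1) → ℂ, gaussianWeight (Fin.cons r Y : Fin (n + 1) → _) *
        f (someEigenvalueList (Matrix.of (Fin.cons r Y : Fin (n + 1) → _)))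
      = ∫⁻ x : Fin (n + 1) → ℂ, topIntegrand f (x 0) (Matrix.of (eigenRows x Y)) := by
    intro Y hY
    have hS : MeasurableSet (topEigenvalueSet Y) :=
      measurable_prodMk_left (x := Y) measurableSet_topEigenvalueSet
    rw [lintegral_eq_setLIntegral_topEigenvalueSet hY hS
      (fun r => gaussianWeight r * f (someEigenvalueList (Matrix.of r))),
      ← lintegral_indicator hS]
    refine lintegral_congr fun x => ?_
    classical
    unfold topIntegrand restrictLE
    rw [Set.indicator_apply, Set.indicator_apply]
    have hiff : someEigenvalueList (Matrix.of (eigenRows x Y)) ∈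
        {z : Fin (n + 1) → ℂ | ∀ i, LexLE (z i) (x 0)} ↔ x ∈ topEigenvalueSet Y := Iff.rfl
    by_cases hx : x ∈ topEigenvalueSet Y
    · rw [if_pos hx, if_pos (hiff.mpr hx)]
      rfl
    · rw [if_neg hx, if_neg (mt hiff.mp hx), mul_zero, mul_zero]
  have hind : ∀ z : Fin (n + 1) → ℂ, {z | ∀ i, LexLE (z i) (z 0)}.indicator
      (fun z => ENNReal.ofReal (ginibreDensity (n + 1) z) * f z) z
      = ENNReal.ofReal (ginibreDensity (n + 1) z) * restrictLE f (z 0) z := by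
    intro z
    classical
    unfold restrictLE
    rw [Set.indicator_apply, Set.indicator_apply, mul_ite, mul_zero]
    rfl
  have hfinal : ((n : ℝ≥0∞) + 1)⁻¹ * ∫⁻ z, ENNReal.ofReal (ginibreDensity (n + 1) z) * f z
      = ∫⁻ z : Fin (n + 1) → ℂ,
        ENNReal.ofReal (ginibreDensity (n + 1) z) * restrictLE f (z 0) z := by
    rw [lintegral_symmetric_eq_mul hρ (fun z σ => by rw [ginibreDensity_comp_perm, hs]),
      ← mul_assoc, ENNReal.inv_mul_cancel (by simp) (by simp), one_mul]
    exact lintegral_congr hind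
  have hswap : AEMeasurable (Function.uncurry fun (Y : Fin n → Fin (n + 1) → ℂ)
      (x : Fin (n + 1) → ℂ) => topIntegrand f (x 0) (Matrix.of (eigenRows x Y)))
      ((volume : Measure (Fin n → Fin (n + 1) → ℂ)).prod volume) :=
    (hT.comp measurable_swap).aemeasurable
  have hswap' : AEMeasurable (Function.uncurry fun (r : Fin (n + 1) → ℂ)
      (Y : Fin n → Fin (n + 1) → ℂ) => gaussianWeight (Fin.cons r Y : Fin (n + 1) → _) *
        f (someEigenvalueList (Matrix.of (Fin.cons r Y : Fin (n + 1) → _))))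
      ((volume : Measure (Fin (n + 1) → ℂ)).prod volume) :=
    (hG.comp measurable_fin_cons).aemeasurable
  calc ∫⁻ r : Fin (n + 1) → Fin (n + 1) → ℂ,
        gaussianWeight r * f (someEigenvalueList (Matrix.of r))
      = ∫⁻ Y : Fin n → Fin (n + 1) → ℂ, ∫⁻ r : Fin (n + 1) → ℂ,
          gaussianWeight (Fin.cons r Y : Fin (n + 1) → _) *
          f (someEigenvalueList (Matrix.of (Fin.cons r Y : Fin (n + 1) → _))) := by
        rw [lintegral_fin_cons hG, lintegral_lintegral_swap hswap']
    _ = ∫⁻ Y : Fin n → Fin (n + 1) → ℂ, ∫⁻ x : Fin (n + 1) → ℂ,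
          topIntegrand f (x 0) (Matrix.of (eigenRows x Y)) := by
        apply lintegral_congr_ae
        filter_upwards [hQ] with Y hY
        exact hcv Y hY
    _ = ∫⁻ x : Fin (n + 1) → ℂ, ∫⁻ Y : Fin n → Fin (n + 1) → ℂ,
          topIntegrand f (x 0) (Matrix.of (eigenRows x Y)) := lintegral_lintegral_swap hswap
    _ = ∫⁻ l : ℂ, ∫⁻ v : Fin n → ℂ, ∫⁻ Y : Fin n → Fin (n + 1) → ℂ,
          topIntegrand f l (Matrix.of (eigenRows (Fin.cons l v) Y)) :=
        lintegral_fin_cons hT.lintegral_prod_right'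
    _ = ∫⁻ l : ℂ, ∫⁻ v : Fin n → ℂ, c v * (C' * ∫⁻ z : Fin n → ℂ,
          ENNReal.ofReal (ginibreDensity (n + 1) (Fin.cons l z))
            * restrictLE f l (Fin.cons l z)) := by
        simp_rw [hc _ _ _ (topIntegrand_conj hs _), hC' f hf hs]
    _ = ∫⁻ l : ℂ, ((∫⁻ v, c v) * C') * ∫⁻ z : Fin n → ℂ,
          ENNReal.ofReal (ginibreDensity (n + 1) (Fin.cons l z))
            * restrictLE f l (Fin.cons l z) := by
        simp_rw [lintegral_mul_const _ hcm, mul_assoc]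
    _ = ((∫⁻ v, c v) * C') * ∫⁻ l : ℂ, ∫⁻ z : Fin n → ℂ,
          ENNReal.ofReal (ginibreDensity (n + 1) (Fin.cons l z))
            * restrictLE f l (Fin.cons l z) := by
        rw [lintegral_const_mul]
        exact (hρ'.comp measurable_fin_cons).lintegral_prod_right'
    _ = ((∫⁻ v, c v) * C') * ∫⁻ z : Fin (n + 1) → ℂ,
          ENNReal.ofReal (ginibreDensity (n + 1) z) * restrictLE f (z 0) z := by
        rw [lintegral_fin_cons hρ']
        rfl
    _ = _ := by
        rw [← hfinal, mul_assoc _ ((n : ℝ≥0∞) + 1)⁻¹]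

theorem hasGinibreEigenvalueLaw (N : ℕ) : HasGinibreEigenvalueLaw N := by
  induction N with
  | zero =>
    refine ⟨1, fun f _ _ => ?_⟩
    have h1 : ∀ z : Fin 0 → ℂ, f z = f Fin.elim0 := fun z => congrArg f (Subsingleton.elim _ _)
    simp [gaussianWeight, ginibreDensity, h1, volume_pi]
  | succ n ih => exact hasGinibreEigenvalueLaw_succ ih


/-! ### The law of a complex Ginibre matrix -/

theorem lintegral_prod_fintype {ι E : Type*} [Fintype ι] [MeasureSpace E]
    [SigmaFinite (volume : Measure E)] {f : ι → E → ℝ≥0∞} (hf : ∀ i, Measurable (f i)) :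
    ∫⁻ c : ι → E, ∏ i, f i (c i) = ∏ i, ∫⁻ x, f i x := by
  let e := Fintype.equivFin ι
  have h := volume_measurePreserving_piCongrLeft (fun _ : ι => E) e.symm
  rw [← h.lintegral_comp (by fun_prop), ← e.symm.prod_comp, ← lintegral_prod_fin fun i => hf _]
  refine lintegral_congr fun c => ?_
  rw [← e.symm.prod_comp]
  refine Finset.prod_congr rfl fun i _ => ?_
  congr 1
  exact Equiv.piCongrLeft_apply_apply (fun _ : ι => E) e.symm c i

theorem pi_withDensity_const {ι E : Type*} [Fintype ι] [MeasureSpace E]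
    [SigmaFinite (volume : Measure E)] {f : E → ℝ≥0∞} (hf : Measurable f)
    [SigmaFinite (volume.withDensity f)] :
    Measure.pi (fun _ : ι => volume.withDensity f)
      = (volume : Measure (ι → E)).withDensity fun x => ∏ i, f (x i) := by
  refine Measure.pi_eq fun s hs => ?_
  rw [withDensity_apply _ (MeasurableSet.univ_pi hs)]
  simp_rw [withDensity_apply _ (hs _), ← lintegral_indicator (hs _)]
  rw [← lintegral_prod_fintype fun i => hf.indicator (hs i),
    ← lintegral_indicator (MeasurableSet.univ_pi hs)]
  refine lintegral_congr fun x => ?_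
  classical
  by_cases hx : x ∈ Set.univ.pi s
  · rw [Set.indicator_of_mem hx]
    exact Finset.prod_congr rfl fun i _ => (Set.indicator_of_mem (hx i trivial) f).symm
  · rw [Set.indicator_of_notMem hx]
    simp only [Set.mem_pi, Set.mem_univ, true_implies, not_forall] at hx
    obtain ⟨i, hi⟩ := hx
    exact (Finset.prod_eq_zero (Finset.mem_univ i) (Set.indicator_of_notMem hi f)).symm

/-- The complex matrix with given real coordinates. -/
def matrixOfCoordinates (N : ℕ) :
    ((Fin N × Fin N) × Bool → ℝ) ≃ₗ[ℝ] (Fin N → Fin N → ℂ) where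
  toFun x i j := ⟨x ((i, j), true), x ((i, j), false)⟩
  invFun c p := if p.2 then (c p.1.1 p.1.2).re else (c p.1.1 p.1.2).im
  left_inv x := by
    ext ⟨⟨i, j⟩, b⟩
    cases b <;> rfl
  right_inv c := by
    ext i j
    rfl
  map_add' x y := by
    ext i j
    rfl
  map_smul' r x := by
    ext i j
    apply Complex.ext <;> simp

theorem gaussianPDF_half (x : ℝ) : gaussianPDF 0 (1 / 2) x
    = ENNReal.ofReal (√Real.pi)⁻¹ * ENNReal.ofReal (Real.exp (-x ^ 2)) := by
  rw [gaussianPDF, gaussianPDFReal, ← ENNReal.ofReal_mul (by positivity)]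
  congr 3
  · congr 1
    push_cast
    ring
  · push_cast
    ring_nf

/-- With variance `1/2` each real coordinate has density proportional to `exp (-x²)`, so the real
and imaginary parts of an entry `c` combine into `exp (-|c|²)`. -/
theorem IsComplexGinibre.exists_lintegral_eq {Ω : Type*} [MeasurableSpace Ω] {P : Measure Ω}
    [IsProbabilityMeasure P] {N : ℕ} {M : Ω → Matrix (Fin N) (Fin N) ℂ}
    (hM : IsComplexGinibre P M) :
    ∃ C : ℝ≥0∞, ∀ g : (Fin N → Fin N → ℂ) → ℝ≥0∞, Measurable g →
      ∫⁻ ω, g (M ω) ∂P = C * ∫⁻ c, gaussianWeight c * g c := by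
  have hX : ∀ p : (Fin N × Fin N) × Bool, Measurable fun ω => realCoordinate p (M ω) := by
    rintro ⟨⟨i, j⟩, b⟩
    cases b
    · exact Complex.measurable_im.comp (hM.measurable_entry i j)
    · exact Complex.measurable_re.comp (hM.measurable_entry i j)
  have hlaw := (iIndepFun_iff_map_fun_eq_pi_map fun p => (hX p).aemeasurable).mp hM.indep
  simp_rw [hM.law, gaussianReal_of_var_ne_zero 0 (by simp : (1 / 2 : ℝ≥0) ≠ 0)] at hlaw
  have : IsProbabilityMeasure ((volume : Measure ℝ).withDensity (gaussianPDF 0 (1 / 2))) := by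
    rw [← gaussianReal_of_var_ne_zero 0 (by simp : (1 / 2 : ℝ≥0) ≠ 0)]
    infer_instance
  rw [pi_withDensity_const (measurable_gaussianPDF _ _)] at hlaw
  obtain ⟨c, hc⟩ := exists_lintegral_eq_mul_lintegral_comp (matrixOfCoordinates N).symm
  let K : ℝ≥0∞ := ENNReal.ofReal (√Real.pi)⁻¹ ^ Fintype.card ((Fin N × Fin N) × Bool)
  refine ⟨c * K, fun g hg => ?_⟩
  have hL : Measurable (matrixOfCoordinates N) :=
    (matrixOfCoordinates N).toContinuousLinearEquiv.continuous.measurable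
  have hgL : Measurable fun x => g (matrixOfCoordinates N x) := hg.comp hL
  have hpdf : Measurable fun x : (Fin N × Fin N) × Bool → ℝ =>
      ∏ p, gaussianPDF 0 (1 / 2) (x p) :=
    Finset.measurable_prod _ fun p _ =>
      (measurable_gaussianPDF _ _).comp (measurable_pi_apply p)
  have hE : ∀ ω, (M ω : Fin N → Fin N → ℂ)
      = matrixOfCoordinates N fun p => realCoordinate p (M ω) := fun ω => by
    ext i j
    rfl
  calc ∫⁻ ω, g (M ω) ∂P
      = ∫⁻ ω, g (matrixOfCoordinates N fun p => realCoordinate p (M ω)) ∂P := rfl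
    _ = ∫⁻ x, g (matrixOfCoordinates N x) ∂P.map fun ω p => realCoordinate p (M ω) :=
        (lintegral_map hgL (measurable_pi_lambda _ hX)).symm
    _ = ∫⁻ x : (Fin N × Fin N) × Bool → ℝ,
          (∏ p, gaussianPDF 0 (1 / 2) (x p)) * g (matrixOfCoordinates N x) := by
        rw [hlaw, lintegral_withDensity_eq_lintegral_mul _ hpdf hgL]
        rfl
    _ = c * ∫⁻ a, K * (gaussianWeight a * g a) := by
        rw [hc]
        congr 1
        refine lintegral_congr fun a => ?_
        rw [LinearEquiv.apply_symm_apply, ← mul_assoc]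
        congr 1
        simp_rw [gaussianPDF_half, Finset.prod_mul_distrib, Finset.prod_const, Finset.card_univ]
        congr 1
        rw [gaussianWeight_eq_prod, Fintype.prod_prod_type, Fintype.prod_prod_type]
        refine Finset.prod_congr rfl fun i _ => Finset.prod_congr rfl fun j _ => ?_
        rw [Fintype.prod_bool, ← ENNReal.ofReal_mul (Real.exp_pos _).le, ← Real.exp_add,
          ← Complex.normSq_eq_norm_sq, Complex.normSq_apply]
        congr 2
        simp only [matrixOfCoordinates, LinearEquiv.coe_symm_mk', if_true]
        simp
        ring
    _ = c * K * ∫⁻ a, gaussianWeight a * g a := by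
        rw [lintegral_const_mul' _ _ (by simp [K]), mul_assoc]


/-! ### The Ginibre kernel -/

/-- The orthonormal functions `√γ(z) z^l / √l!`. -/
noncomputable def ginibreMode (l : ℕ) (z : ℂ) : ℂ :=
  (√(ginibreWeight z) : ℂ) * (z ^ l / (√(l ! : ℝ) : ℂ))

theorem continuous_ginibreMode (l : ℕ) : Continuous (ginibreMode l) := by
  unfold ginibreMode ginibreWeight
  fun_prop

/-- This mode expansion reduces the kernel integrals to orthonormality of the modes. -/
theorem ginibreKernel_eq_sum (N : ℕ) (z w : ℂ) :
    ginibreKernel N z w = ∑ l ∈ Finset.range N, ginibreMode l z * conj (ginibreMode l w) := by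
  unfold ginibreKernel ginibreMode
  rw [Real.sqrt_mul (ginibreWeight_pos z).le, Finset.mul_sum]
  refine Finset.sum_congr rfl fun l _ => ?_
  have h1 : ((l ! : ℕ) : ℂ) = (√(l ! : ℝ) : ℂ) * (√(l ! : ℝ) : ℂ) := by
    rw [← Complex.ofReal_mul, Real.mul_self_sqrt (by positivity)]
    simp
  rw [h1]
  simp only [map_mul, map_div₀, map_pow, Complex.conj_ofReal, Complex.ofReal_mul, mul_pow]
  have h2 : (√(l ! : ℝ) : ℂ) ≠ 0 := by
    simp [Nat.factorial_ne_zero]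
  field_simp

theorem norm_ginibreMode_sq (l : ℕ) (z : ℂ) :
    ‖ginibreMode l z‖ ^ 2
      = (Real.pi * l !)⁻¹ * (‖z‖ ^ (2 * l) * Real.exp (-‖z‖ ^ 2)) := by
  unfold ginibreMode
  rw [norm_mul, norm_div, norm_pow, Complex.norm_real, Complex.norm_real, Real.norm_eq_abs,
    Real.norm_eq_abs, mul_pow, div_pow, sq_abs, sq_abs, Real.sq_sqrt (ginibreWeight_pos z).le,
    Real.sq_sqrt (by positivity), ginibreWeight, ← pow_mul, mul_comm l 2]
  have := Real.pi_ne_zero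
  have : (l ! : ℝ) ≠ 0 := by positivity
  field_simp

theorem integrable_norm_ginibreMode_sq (l : ℕ) : Integrable fun z => ‖ginibreMode l z‖ ^ 2 := by
  simp_rw [norm_ginibreMode_sq]
  exact (integrable_norm_pow_mul_exp l).1.const_mul _

theorem integral_norm_ginibreMode_sq (l : ℕ) : ∫ z, ‖ginibreMode l z‖ ^ 2 = 1 := by
  simp_rw [norm_ginibreMode_sq]
  rw [integral_const_mul, (integrable_norm_pow_mul_exp l).2, inv_mul_cancel₀]
  have := Real.pi_pos
  positivity

theorem integrable_ginibreMode_mul (l m : ℕ) :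
    Integrable fun z => ginibreMode l z * conj (ginibreMode m z) := by
  refine ((integrable_norm_ginibreMode_sq l).add (integrable_norm_ginibreMode_sq m)).mono'
    ((continuous_ginibreMode l).mul
      (Complex.continuous_conj.comp (continuous_ginibreMode m))).aestronglyMeasurable
    (Filter.Eventually.of_forall fun z => ?_)
  rw [norm_mul, RCLike.norm_conj, Pi.add_apply]
  nlinarith [sq_nonneg (‖ginibreMode l z‖ - ‖ginibreMode m z‖), sq_nonneg ‖ginibreMode l z‖,
    sq_nonneg ‖ginibreMode m z‖]

theorem ginibreMode_mul_unit (l : ℕ) {u : ℂ} (hu : ‖u‖ = 1) (z : ℂ) :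
    ginibreMode l (u * z) = u ^ l * ginibreMode l z := by
  unfold ginibreMode ginibreWeight
  rw [norm_mul, hu, one_mul, mul_pow]
  ring

theorem integral_ginibreMode_mul_of_ne {l m : ℕ} (h : l ≠ m) :
    ∫ z, ginibreMode l z * conj (ginibreMode m z) = 0 := by
  -- The angle makes `u ^ l * conj (u ^ m) = -1`. Rotation by `u` preserves the measure, so the
  -- integral equals its own negative.
  let u : Circle := Circle.exp (Real.pi / ((l : ℝ) - m))
  have hu : ‖(u : ℂ)‖ = 1 := Circle.norm_coe u
  have h1 := (rotation u).measurePreserving.integral_comp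
    (rotation u).toHomeomorph.measurableEmbedding
    fun z => ginibreMode l z * conj (ginibreMode m z)
  have hlm : (l : ℂ) - m ≠ 0 := sub_ne_zero.mpr (by exact_mod_cast h)
  have h2 : (u : ℂ) ^ l * conj ((u : ℂ) ^ m) = -1 := by
    rw [map_pow]
    simp only [u, Circle.coe_exp]
    rw [← Complex.exp_conj, ← Complex.exp_nat_mul, ← Complex.exp_nat_mul, ← Complex.exp_add,
      ← Complex.exp_pi_mul_I]
    congr 1
    simp
    field_simp
    ring
  have h3 : ∀ z, ginibreMode l (rotation u z) * conj (ginibreMode m (rotation u z))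
      = -(ginibreMode l z * conj (ginibreMode m z)) := by
    intro z
    rw [rotation_apply, ginibreMode_mul_unit l hu, ginibreMode_mul_unit m hu, map_mul,
      mul_mul_mul_comm, h2, neg_one_mul]
  simp_rw [h3, integral_neg] at h1
  have h4 : (2 : ℂ) * ∫ z, ginibreMode l z * conj (ginibreMode m z) = 0 := by
    rw [two_mul]
    nth_rewrite 1 [← h1]
    ring
  simpa using h4

theorem integral_ginibreMode_mul (l m : ℕ) :
    ∫ z, ginibreMode l z * conj (ginibreMode m z) = if l = m then 1 else 0 := by
  split_ifs with h
  · subst h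
    simp_rw [Complex.mul_conj, Complex.normSq_eq_norm_sq]
    rw [integral_complex_ofReal, integral_norm_ginibreMode_sq, Complex.ofReal_one]
  · exact integral_ginibreMode_mul_of_ne h

theorem integral_ginibreKernel_self (N : ℕ) :
    Integrable (fun t => ginibreKernel N t t) ∧ ∫ t, ginibreKernel N t t = N := by
  simp_rw [ginibreKernel_eq_sum]
  constructor
  · exact integrable_finsetSum _ fun l _ => integrable_ginibreMode_mul l l
  · rw [integral_finsetSum _ fun l _ => integrable_ginibreMode_mul l l]
    simp [integral_ginibreMode_mul]

/-- The reproducing property: by orthonormality only the diagonal terms of the double sum over modes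
survive. -/
theorem integral_ginibreKernel_mul (N : ℕ) (z w : ℂ) :
    Integrable (fun t => ginibreKernel N t z * ginibreKernel N w t) ∧
      ∫ t, ginibreKernel N t z * ginibreKernel N w t = ginibreKernel N w z := by
  have h : ∀ t, ginibreKernel N t z * ginibreKernel N w t
      = ∑ l ∈ Finset.range N, ∑ m ∈ Finset.range N,
        (conj (ginibreMode l z) * ginibreMode m w) *
          (ginibreMode l t * conj (ginibreMode m t)) := by
    intro t
    rw [ginibreKernel_eq_sum, ginibreKernel_eq_sum, Finset.sum_mul_sum]
    exact Finset.sum_congr rfl fun l _ => Finset.sum_congr rfl fun m _ => by ring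
  have hi : ∀ l m, Integrable fun t => (conj (ginibreMode l z) * ginibreMode m w) *
      (ginibreMode l t * conj (ginibreMode m t)) := fun l m =>
    (integrable_ginibreMode_mul l m).const_mul _
  simp_rw [h]
  constructor
  · exact integrable_finsetSum _ fun l _ => integrable_finsetSum _ fun m _ => hi l m
  · rw [integral_finsetSum _ fun l _ => integrable_finsetSum _ fun m _ => hi l m]
    simp_rw [integral_finsetSum _ fun m _ => hi _ m, integral_const_mul, integral_ginibreMode_mul]
    rw [ginibreKernel_eq_sum]
    refine Finset.sum_congr rfl fun l hl => ?_
    simp only [mul_ite, mul_one, mul_zero, Finset.sum_ite_eq, hl, if_true]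
    ring

/-! ### Bordered determinants -/

/-- For invertible `A` this is the Schur complement formula. Both sides are continuous and `t + A`
is invertible for all but finitely many `t`. The adjugate form is needed since a kernel matrix can
be singular. -/
theorem det_fromBlocks_eq_sub_adjugate {m : Type*} [Fintype m] [DecidableEq m] (A : Matrix m m ℂ)
    (u : Matrix m (Fin 1) ℂ) (v : Matrix (Fin 1) m ℂ) (d : Matrix (Fin 1) (Fin 1) ℂ) :
    (Matrix.fromBlocks A u v d).det = A.det * d 0 0 - (v * A.adjugate * u) 0 0 := by
  have hinv : ∀ B : Matrix m m ℂ, B.det ≠ 0 →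
      (Matrix.fromBlocks B u v d).det = B.det * d 0 0 - (v * B.adjugate * u) 0 0 := by
    intro B hB
    have := Matrix.invertibleOfIsUnitDet B (isUnit_iff_ne_zero.mpr hB)
    rw [Matrix.det_fromBlocks₁₁, Matrix.det_fin_one, Matrix.sub_apply, mul_sub,
      Matrix.invOf_eq_nonsing_inv, Matrix.inv_def, Ring.inverse_eq_inv', Matrix.mul_smul,
      Matrix.smul_mul, Matrix.smul_apply, smul_eq_mul, mul_inv_cancel_left₀ hB]
  have hdense : Dense {t : ℂ | (Matrix.scalar m t + A).det ≠ 0} := by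
    have hfin : Set.Finite {t : ℂ | (-A).charpoly.IsRoot t} :=
      Polynomial.finite_setOfPred_isRoot (Matrix.charpoly_monic _).ne_zero
    refine (hfin.countable.dense_compl ℂ).mono fun t ht => ?_
    rw [Set.mem_ofPred_eq]
    intro h
    refine ht ?_
    rw [Set.mem_ofPred_eq, Polynomial.IsRoot, Matrix.eval_charpoly, sub_neg_eq_add, h]
  have hc : Continuous fun t : ℂ => Matrix.scalar m t + A :=
    (Continuous.matrix_diagonal (continuous_pi fun _ => continuous_id)).add continuous_const
  have hf : Continuous fun t : ℂ => (Matrix.fromBlocks (Matrix.scalar m t + A) u v d).det :=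
    (hc.matrix_fromBlocks continuous_const continuous_const continuous_const).matrix_det
  have hg : Continuous fun t : ℂ => (Matrix.scalar m t + A).det * d 0 0
      - (v * (Matrix.scalar m t + A).adjugate * u) 0 0 :=
    (hc.matrix_det.mul continuous_const).sub
      (((continuous_const.matrix_mul hc.matrix_adjugate).matrix_mul
        continuous_const).matrix_elem 0 0)
  have := congrFun (hf.ext_on hdense hg fun t ht => hinv _ ht) 0
  simpa using this

/-! ### Integration of the kernel determinants -/

/-- The matrix of the values of the modes at the points `z`. -/
noncomputable def modeMatrix (N : ℕ) {k : ℕ} (z : Fin k → ℂ) : Matrix (Fin k) (Fin N) ℂ :=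
  Matrix.of fun i l => ginibreMode l (z i)

/-- This Gram factorization gives positivity, vanishing beyond `N` points, and the Vandermonde
formula. -/
theorem kernelMatrix_eq_mul (N : ℕ) {k : ℕ} (z : Fin k → ℂ) :
    (Matrix.of fun i j => ginibreKernel N (z i) (z j))
      = modeMatrix N z * (modeMatrix N z).conjTranspose := by
  ext i j
  simp [Matrix.mul_apply, modeMatrix, ginibreKernel_eq_sum, Finset.sum_range]

/-- The determinant `det [K_N(z_i, z_j)]` as a real number. -/
noncomputable def kernelDetReal (N : ℕ) {k : ℕ} (z : Fin k → ℂ) : ℝ :=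
  (kernelDet (ginibreKernel N) z).re

open ComplexOrder in
theorem kernelDet_ginibreKernel_nonneg (N : ℕ) {k : ℕ} (z : Fin k → ℂ) :
    0 ≤ kernelDet (ginibreKernel N) z := by
  unfold kernelDet
  rw [kernelMatrix_eq_mul]
  exact (Matrix.posSemidef_self_mul_conjTranspose _).det_nonneg

theorem kernelDetReal_nonneg (N : ℕ) {k : ℕ} (z : Fin k → ℂ) : 0 ≤ kernelDetReal N z :=
  (Complex.le_def.mp (kernelDet_ginibreKernel_nonneg N z)).1

theorem ofReal_kernelDetReal (N : ℕ) {k : ℕ} (z : Fin k → ℂ) :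
    (kernelDetReal N z : ℂ) = kernelDet (ginibreKernel N) z :=
  Complex.ext rfl (Complex.le_def.mp (kernelDet_ginibreKernel_nonneg N z)).2

/-- The Gram factorization has rank at most `N`, too small for a `k × k` matrix to be invertible. -/
theorem kernelDetReal_eq_zero {N k : ℕ} (h : N < k) (z : Fin k → ℂ) : kernelDetReal N z = 0 := by
  unfold kernelDetReal kernelDet
  rw [kernelMatrix_eq_mul]
  by_contra hne
  have h1 : (modeMatrix N z * (modeMatrix N z).conjTranspose).det ≠ 0 := fun h0 => hne (by
    rw [h0, Complex.zero_re])
  have h2 := Matrix.rank_of_isUnit _ ((Matrix.isUnit_iff_isUnit_det _).mpr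
    (isUnit_iff_ne_zero.mpr h1))
  have h3 := Matrix.rank_mul_le_left (modeMatrix N z) (modeMatrix N z).conjTranspose
  have h4 := (modeMatrix N z).rank_le_width
  rw [Fintype.card_fin] at h2
  omega

theorem continuous_kernelDetReal (N k : ℕ) :
    Continuous fun z : Fin k → ℂ => kernelDetReal N z := by
  unfold kernelDetReal kernelDet
  refine Complex.continuous_re.comp (Continuous.matrix_det ?_)
  refine continuous_matrix fun i j => ?_
  simp only [Matrix.of_apply, ginibreKernel_eq_sum]
  exact continuous_finsetSum _ fun l _ =>
    ((continuous_ginibreMode l).comp (continuous_apply i)).mul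
      (Complex.continuous_conj.comp ((continuous_ginibreMode l).comp (continuous_apply j)))

theorem kernelDet_snoc (N : ℕ) {k : ℕ} (z : Fin k → ℂ) (t : ℂ) :
    kernelDet (ginibreKernel N) (Fin.snoc z t : Fin (k + 1) → ℂ)
      = kernelDet (ginibreKernel N) z * ginibreKernel N t t
        - ∑ j, ∑ i, (Matrix.of fun i j => ginibreKernel N (z i) (z j)).adjugate i j *
          (ginibreKernel N t (z i) * ginibreKernel N (z j) t) := by
  have h1 : (Matrix.of fun i j => ginibreKernel N ((Fin.snoc z t : Fin (k + 1) → ℂ) i)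
      ((Fin.snoc z t : Fin (k + 1) → ℂ) j)).submatrix finSumFinEquiv finSumFinEquiv
      = Matrix.fromBlocks (Matrix.of fun i j => ginibreKernel N (z i) (z j))
        (Matrix.of fun i _ => ginibreKernel N (z i) t)
        (Matrix.of fun _ j => ginibreKernel N t (z j))
        (Matrix.of fun _ _ => ginibreKernel N t t) := by
    have hc : ∀ i : Fin k, (Fin.snoc z t : Fin (k + 1) → ℂ) (Fin.castAdd 1 i) = z i :=
      fun i => Fin.snoc_castSucc (α := fun _ => ℂ) t z i
    have hl : ∀ i : Fin 1, (Fin.snoc z t : Fin (k + 1) → ℂ) (Fin.natAdd k i) = t := by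
      intro i
      rw [Subsingleton.elim i 0]
      exact Fin.snoc_last (α := fun _ => ℂ) t z
    ext i j
    rcases i with i | i <;> rcases j with j | j <;> simp [hc, hl]
  rw [kernelDet, ← Matrix.det_submatrix_equiv_self finSumFinEquiv, h1,
    det_fromBlocks_eq_sub_adjugate]
  congr 1
  simp only [Matrix.mul_apply, Matrix.of_apply, Finset.sum_mul]
  exact Finset.sum_congr rfl fun j _ => Finset.sum_congr rfl fun i _ => by ring

/-- The corner entry integrates to `N`. By the reproducing property, the adjugate term becomes the
trace of a matrix times its adjugate, that is, `k` times the determinant. -/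
theorem integral_kernelDet_snoc (N : ℕ) {k : ℕ} (z : Fin k → ℂ) :
    Integrable (fun t => kernelDet (ginibreKernel N) (Fin.snoc z t : Fin (k + 1) → ℂ)) ∧
      ∫ t, kernelDet (ginibreKernel N) (Fin.snoc z t : Fin (k + 1) → ℂ)
        = (N - k) * kernelDet (ginibreKernel N) z := by
  simp_rw [kernelDet_snoc]
  have h1 := integral_ginibreKernel_self N
  have h2 := integral_ginibreKernel_mul N
  have h3 : ∀ i j, Integrable fun t =>
      (Matrix.of fun i j => ginibreKernel N (z i) (z j)).adjugate i j *
        (ginibreKernel N t (z i) * ginibreKernel N (z j) t) := fun i j =>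
    (h2 (z i) (z j)).1.const_mul _
  have h4 := integrable_finsetSum Finset.univ fun (j : Fin k) _ =>
    integrable_finsetSum Finset.univ fun i _ => h3 i j
  refine ⟨(h1.1.const_mul _).sub h4, ?_⟩
  rw [integral_sub (h1.1.const_mul _) h4, integral_const_mul, h1.2,
    integral_finsetSum _ fun j _ => integrable_finsetSum _ fun i _ => h3 i j]
  simp_rw [integral_finsetSum _ fun i _ => h3 i _, integral_const_mul, (h2 _ _).2]
  have h5 : ∑ j, ∑ i, (Matrix.of fun i j => ginibreKernel N (z i) (z j)).adjugate i j *
      ginibreKernel N (z j) (z i) = k * kernelDet (ginibreKernel N) z := by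
    have h6 := congrArg Matrix.trace
      (Matrix.mul_adjugate (Matrix.of fun i j => ginibreKernel N (z i) (z j)))
    rw [Matrix.trace_smul, Matrix.trace_one, Fintype.card_fin, smul_eq_mul, mul_comm] at h6
    rw [kernelDet, ← h6, Matrix.trace]
    simp only [Matrix.diag, Matrix.mul_apply, Matrix.of_apply]
    exact Finset.sum_congr rfl fun j _ => Finset.sum_congr rfl fun i _ => mul_comm _ _
  rw [h5]
  ring

theorem lintegral_kernelDetReal_snoc (N : ℕ) {k : ℕ} (z : Fin k → ℂ) :
    ∫⁻ t, ENNReal.ofReal (kernelDetReal N (Fin.snoc z t : Fin (k + 1) → ℂ))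
      = ENNReal.ofReal ((N - k) * kernelDetReal N z) := by
  have h := integral_kernelDet_snoc N z
  have hi : Integrable fun t => kernelDetReal N (Fin.snoc z t : Fin (k + 1) → ℂ) := h.1.re
  rw [← ofReal_integral_eq_lintegral_ofReal hi
    (Filter.Eventually.of_forall fun t => kernelDetReal_nonneg N _)]
  congr 1
  have h1 := integral_re h.1
  rw [h.2] at h1
  refine h1.trans ?_
  rw [← ofReal_kernelDetReal]
  have : ((N : ℂ) - k) * (kernelDetReal N z : ℂ) = (((N - k) * kernelDetReal N z : ℝ) : ℂ) := by
    push_cast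
    ring
  rw [this]
  rfl

theorem lintegral_fin_snoc {E : Type*} [MeasureSpace E] [SigmaFinite (volume : Measure E)] {n : ℕ}
    {g : (Fin (n + 1) → E) → ℝ≥0∞} (hg : Measurable g) :
    ∫⁻ c, g c = ∫⁻ Y : Fin n → E, ∫⁻ r : E, g (Fin.snoc Y r) := by
  have h := (volume_preserving_piFinSuccAbove (fun _ : Fin (n + 1) => E) (Fin.last n)).symm
  have hE : ∀ p : E × (Fin n → E), (MeasurableEquiv.piFinSuccAbove
      (fun _ : Fin (n + 1) => E) (Fin.last n)).symm p = Fin.snoc p.2 p.1 :=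
    fun p => Fin.insertNth_last' p.1 p.2
  rw [← h.lintegral_comp hg, Measure.volume_eq_prod, lintegral_prod_symm]
  · simp only [hE]
  · exact (hg.comp (MeasurableEquiv.measurable _)).aemeasurable

theorem lintegral_kernelDetReal_append (N : ℕ) {k : ℕ} (z : Fin k → ℂ) (m : ℕ) (h : k + m ≤ N) :
    ∫⁻ w : Fin m → ℂ, ENNReal.ofReal (kernelDetReal N (Fin.append z w))
      = ENNReal.ofReal ((∏ i ∈ Finset.range m, ((N : ℝ) - k - i)) * kernelDetReal N z) := by
  induction m with
  | zero => simp [volume_pi, Fin.append_right_nil]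
  | succ m ih =>
    have hm : Measurable fun w : Fin (m + 1) → ℂ =>
        ENNReal.ofReal (kernelDetReal N (Fin.append z w)) := by
      refine Measurable.ennreal_ofReal ((continuous_kernelDetReal N _).measurable.comp ?_)
      refine measurable_pi_lambda _ fun i => ?_
      refine Fin.addCases (fun i => ?_) (fun i => ?_) i
      · simp
      · have hE : (fun w : Fin (m + 1) → ℂ => Fin.append z w (Fin.natAdd k i)) = fun w => w i :=
          funext fun w => Fin.append_right z w i
        exact (congrArg Measurable hE).mpr (measurable_pi_apply i)
    rw [lintegral_fin_snoc hm]
    have hs : ∀ (w : Fin m → ℂ) (t : ℂ),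
        Fin.append z (Fin.snoc w t : Fin (m + 1) → ℂ) = Fin.snoc (Fin.append z w) t :=
      fun w t => Fin.append_snoc z w t
    simp_rw [hs]
    have hpos : (0 : ℝ) ≤ (N : ℝ) - (k + m : ℕ) := by
      have : ((k + m : ℕ) : ℝ) ≤ N := by exact_mod_cast (by omega : k + m ≤ N)
      linarith
    rw [lintegral_congr fun w => (lintegral_kernelDetReal_snoc N (Fin.append z w)).trans
      (ENNReal.ofReal_mul hpos)]
    rw [lintegral_const_mul' _ _ ENNReal.ofReal_ne_top, ih (by omega), ← ENNReal.ofReal_mul hpos,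
      Finset.prod_range_succ]
    congr 1
    push_cast
    ring


/-! ### The density as a determinant, and its marginals -/

theorem prod_Icc_factorial (N : ℕ) :
    ∏ k ∈ Finset.Icc 1 N, (k ! : ℝ) = N ! * ∏ l : Fin N, ((l : ℕ)! : ℝ) := by
  rw [← Finset.prod_range fun l => (l ! : ℝ)]
  induction N with
  | zero => simp
  | succ n ih =>
    rw [Finset.prod_Icc_succ_top (by omega), ih, Finset.prod_range_succ]
    ring

/-- At `N` points the mode matrix is the Vandermonde matrix with rows scaled by `√γ(z_i)` and
columns by `1/√l!`. The shift from `∏ l!` over `l < N` to `∏ k!` over `1 ≤ k ≤ N` supplies the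
factor `N!`. -/
theorem ginibreDensity_eq_kernelDetReal {N : ℕ} (z : Fin N → ℂ) :
    ginibreDensity N z = (N ! : ℝ)⁻¹ * kernelDetReal N z := by
  have hA : modeMatrix N z = Matrix.diagonal (fun i => (√(ginibreWeight (z i)) : ℂ))
      * Matrix.vandermonde z * Matrix.diagonal (fun l : Fin N => (√((l : ℕ)! : ℝ) : ℂ)⁻¹) := by
    ext i l
    simp [modeMatrix, ginibreMode, Matrix.vandermonde, div_eq_mul_inv, mul_assoc]
  have hdet : kernelDet (ginibreKernel N) z = ((‖(modeMatrix N z).det‖ ^ 2 : ℝ) : ℂ) := by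
    unfold kernelDet
    rw [kernelMatrix_eq_mul, Matrix.det_mul, Matrix.det_conjTranspose, Complex.star_def,
      Complex.mul_conj, Complex.normSq_eq_norm_sq]
  have hnorm : ‖(modeMatrix N z).det‖ ^ 2 = (∏ i, ginibreWeight (z i))
      * ‖(Matrix.vandermonde z).det‖ ^ 2 / ∏ l : Fin N, ((l : ℕ)! : ℝ) := by
    rw [hA, Matrix.det_mul, Matrix.det_mul, Matrix.det_diagonal, Matrix.det_diagonal, norm_mul,
      norm_mul, norm_prod, norm_prod, mul_pow, mul_pow, ← Finset.prod_pow, ← Finset.prod_pow]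
    have h1 : ∀ i, ‖(√(ginibreWeight (z i)) : ℂ)‖ ^ 2 = ginibreWeight (z i) := by
      intro i
      rw [Complex.norm_real, Real.norm_eq_abs, sq_abs, Real.sq_sqrt (ginibreWeight_pos _).le]
    have h2 : ∀ l : Fin N, ‖(√((l : ℕ)! : ℝ) : ℂ)⁻¹‖ ^ 2 = ((l : ℕ)! : ℝ)⁻¹ := by
      intro l
      rw [norm_inv, inv_pow, Complex.norm_real, Real.norm_eq_abs, sq_abs,
        Real.sq_sqrt (by positivity)]
    simp_rw [h1, h2, Finset.prod_inv_distrib]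
    ring
  have hre : kernelDetReal N z = ‖(modeMatrix N z).det‖ ^ 2 := by
    rw [kernelDetReal, hdet, Complex.ofReal_re]
  rw [hre, hnorm, ginibreDensity, prod_norm_sub_sq_eq_vandermonde, prod_Icc_factorial]
  have h1 : (N ! : ℝ) ≠ 0 := by positivity
  have h2 : ∏ l : Fin N, ((l : ℕ)! : ℝ) ≠ 0 :=
    Finset.prod_ne_zero_iff.mpr fun l _ => by positivity
  field_simp

theorem kernelDetReal_comp_cast {N a b : ℕ} (h : a = b) (z : Fin b → ℂ) :
    kernelDetReal N (fun i => z (Fin.cast h i)) = kernelDetReal N z := by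
  subst h
  rfl

theorem kernelDetReal_joinPoints {N k : ℕ} (h : k ≤ N) (z : Fin k → ℂ) (w : Fin (N - k) → ℂ) :
    kernelDetReal N (joinPoints h z w) = kernelDetReal N (Fin.append z w) :=
  kernelDetReal_comp_cast (Nat.add_sub_of_le h).symm (Fin.append z w)

theorem prod_range_sub_eq_factorial {N k : ℕ} (h : k ≤ N) :
    ∏ i ∈ Finset.range (N - k), ((N : ℝ) - k - i) = (N - k)! := by
  obtain ⟨m, rfl⟩ := Nat.exists_eq_add_of_le h
  rw [Nat.add_sub_cancel_left]
  have : ∏ i ∈ Finset.range m, (((k + m : ℕ) : ℝ) - k - i)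
      = ∏ i ∈ Finset.range m, ((m - 1 - i + 1 : ℕ) : ℝ) := by
    refine Finset.prod_congr rfl fun i hi => ?_
    have h1 : i < m := Finset.mem_range.mp hi
    have h2 : m - 1 - i + 1 = m - i := by omega
    rw [h2, Nat.cast_sub h1.le]
    push_cast
    ring
  rw [this, Finset.prod_range_reflect (fun i => ((i + 1 : ℕ) : ℝ)) m, ← Nat.cast_prod,
    Finset.prod_range_add_one_eq_factorial]

theorem measurable_joinPoints {N k : ℕ} (h : k ≤ N) :
    Measurable fun p : (Fin k → ℂ) × (Fin (N - k) → ℂ) => joinPoints h p.1 p.2 := by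
  refine measurable_pi_lambda _ fun i => ?_
  unfold joinPoints
  generalize Fin.cast (Nat.add_sub_of_le h).symm i = j
  refine Fin.addCases (fun j => ?_) (fun j => ?_) j
  · simp only [Fin.append_left]
    exact (measurable_pi_apply j).comp measurable_fst
  · simp only [Fin.append_right]
    exact (measurable_pi_apply j).comp measurable_snd

theorem lintegral_ginibreDensity_joinPoints {N k : ℕ} (h : k ≤ N) (z : Fin k → ℂ) :
    ∫⁻ w, ENNReal.ofReal (ginibreDensity N (joinPoints h z w))
      = ENNReal.ofReal ((N - k)! / N ! * kernelDetReal N z) := by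
  have hN : (0 : ℝ) ≤ (N ! : ℝ)⁻¹ := by positivity
  simp_rw [ginibreDensity_eq_kernelDetReal, kernelDetReal_joinPoints, ENNReal.ofReal_mul hN]
  rw [lintegral_const_mul' _ _ ENNReal.ofReal_ne_top,
    lintegral_kernelDetReal_append N z (N - k) (Nat.add_sub_of_le h).le,
    prod_range_sub_eq_factorial h, ← ENNReal.ofReal_mul hN]
  congr 1
  ring

theorem integrable_ginibreDensity_joinPoints {N k : ℕ} (h : k ≤ N) (z : Fin k → ℂ) :
    Integrable fun w => ginibreDensity N (joinPoints h z w) := by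
  have hm : Measurable fun w => joinPoints h z w :=
    (measurable_joinPoints h).comp (measurable_const.prodMk measurable_id)
  refine ⟨((measurable_ginibreDensity N).comp hm).aestronglyMeasurable, ?_⟩
  rw [hasFiniteIntegral_iff_ofReal
    (Filter.Eventually.of_forall fun w => ginibreDensity_nonneg N _),
    lintegral_ginibreDensity_joinPoints]
  exact ENNReal.ofReal_lt_top

theorem ginibreMarginal_eq {N k : ℕ} (h : k ≤ N) (z : Fin k → ℂ) :
    ginibreMarginal h z = (N - k)! / N ! * kernelDetReal N z := by
  unfold ginibreMarginal
  rw [integral_eq_lintegral_of_nonneg_ae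
    (Filter.Eventually.of_forall fun w => ginibreDensity_nonneg N _)
    (integrable_ginibreDensity_joinPoints h z).1, lintegral_ginibreDensity_joinPoints,
    ENNReal.toReal_ofReal]
  exact mul_nonneg (by positivity) (kernelDetReal_nonneg N z)

theorem lintegral_fin_append {E : Type*} [MeasureSpace E] [SigmaFinite (volume : Measure E)]
    {k m : ℕ} {g : (Fin (k + m) → E) → ℝ≥0∞} (hg : Measurable g) :
    ∫⁻ c, g c = ∫⁻ z : Fin k → E, ∫⁻ w : Fin m → E, g (Fin.append z w) := by
  induction m with
  | zero =>
    refine lintegral_congr fun z => ?_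
    simp [volume_pi, Fin.append_right_nil]
  | succ m ih =>
    have hsnoc : Measurable fun p : (Fin (k + m) → E) × E =>
        (Fin.snoc p.1 p.2 : Fin (k + m + 1) → E) := by
      refine measurable_pi_lambda _ fun i => ?_
      refine Fin.lastCases ?_ (fun i => ?_) i
      · simp only [Fin.snoc_last]
        exact measurable_snd
      · simp only [Fin.snoc_castSucc]
        exact (measurable_pi_apply i).comp measurable_fst
    have h1 : Measurable fun p : (Fin (k + m) → E) × E => g (Fin.snoc p.1 p.2) := hg.comp hsnoc
    have h2 : ∀ z : Fin k → E, Measurable fun w : Fin (m + 1) → E => g (Fin.append z w) := by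
      intro z
      refine hg.comp (measurable_pi_lambda _ fun i => ?_)
      refine Fin.addCases (fun i => ?_) (fun i => ?_) i
      · simp
      · have hE : (fun w : Fin (m + 1) → E => Fin.append z w (Fin.natAdd k i)) = fun w => w i :=
          funext fun w => Fin.append_right z w i
        exact (congrArg Measurable hE).mpr (measurable_pi_apply i)
    refine (lintegral_fin_snoc (n := k + m) hg).trans ?_
    rw [ih h1.lintegral_prod_right']
    refine lintegral_congr fun z => ?_
    rw [lintegral_fin_snoc (h2 z)]
    refine lintegral_congr fun w => lintegral_congr fun r => ?_
    rw [Fin.append_snoc]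

theorem lintegral_comp_fin_cast {E : Type*} [MeasureSpace E] [SigmaFinite (volume : Measure E)]
    {a b : ℕ} (h : a = b) (g : (Fin a → E) → ℝ≥0∞) :
    ∫⁻ c : Fin b → E, g (fun i => c (Fin.cast h i)) = ∫⁻ c, g c := by
  subst h
  rfl

theorem lintegral_joinPoints {N k : ℕ} (h : k ≤ N) {g : (Fin N → ℂ) → ℝ≥0∞} (hg : Measurable g) :
    ∫⁻ c, g c = ∫⁻ z : Fin k → ℂ, ∫⁻ w, g (joinPoints h z w) := by
  rw [← lintegral_comp_fin_cast (Nat.add_sub_of_le h).symm, lintegral_fin_append]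
  · rfl
  · exact hg.comp (measurable_pi_lambda _ fun i => measurable_pi_apply _)

/-- The marginal on no points: the empty determinant is `1`. -/
theorem lintegral_ginibreDensity (N : ℕ) :
    ∫⁻ z : Fin N → ℂ, ENNReal.ofReal (ginibreDensity N z) = 1 := by
  rw [lintegral_joinPoints (Nat.zero_le N) (measurable_ginibreDensity N).ennreal_ofReal]
  simp_rw [lintegral_ginibreDensity_joinPoints]
  simp [volume_pi, kernelDetReal, kernelDet, Nat.factorial_ne_zero]

/-- Both sides are already proportional. Taking `f = 1` shows that the constant is `1`, since both
measures have mass one. -/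
theorem IsComplexGinibre.lintegral_symmetric {Ω : Type*} [MeasurableSpace Ω] {P : Measure Ω}
    [IsProbabilityMeasure P] {N : ℕ} {M : Ω → Matrix (Fin N) (Fin N) ℂ}
    (hM : IsComplexGinibre P M) {f : (Fin N → ℂ) → ℝ≥0∞} (hf : Measurable f)
    (hs : ∀ z (σ : Equiv.Perm (Fin N)), f (z ∘ σ) = f z) :
    ∫⁻ ω, f (someEigenvalueList (M ω)) ∂P
      = ∫⁻ z, ENNReal.ofReal (ginibreDensity N z) * f z := by
  obtain ⟨C, hC⟩ := hM.exists_lintegral_eq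
  obtain ⟨C', hC'⟩ := hasGinibreEigenvalueLaw N
  have key : ∀ f : (Fin N → ℂ) → ℝ≥0∞, Measurable f →
      (∀ z (σ : Equiv.Perm (Fin N)), f (z ∘ σ) = f z) →
      ∫⁻ ω, f (someEigenvalueList (M ω)) ∂P
        = C * C' * ∫⁻ z, ENNReal.ofReal (ginibreDensity N z) * f z := by
    intro f hf hs
    rw [mul_assoc, ← hC' f hf hs,
      ← hC (fun c => f (someEigenvalueList (Matrix.of c))) (measurable_symmetric_eigenvalues' hf hs)]
    rfl
  have h1 := key (fun _ => 1) measurable_const fun _ _ => rfl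
  simp only [lintegral_const, measure_univ, mul_one, lintegral_ginibreDensity] at h1
  rw [key f hf hs, ← h1, one_mul]


/-! ### The law of the spectrum -/

/-- The average of `g` over the permutations of the coordinates. -/
noncomputable def symmetrization {N : ℕ} (g : (Fin N → ℂ) → ℝ≥0∞) (z : Fin N → ℂ) : ℝ≥0∞ :=
  (N ! : ℝ≥0∞)⁻¹ * ∑ σ : Equiv.Perm (Fin N), g (z ∘ σ)

theorem symmetrization_comp_perm {N : ℕ} (g : (Fin N → ℂ) → ℝ≥0∞) (z : Fin N → ℂ)
    (σ : Equiv.Perm (Fin N)) : symmetrization g (z ∘ σ) = symmetrization g z := by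
  unfold symmetrization
  congr 1
  exact Equiv.sum_comp (Equiv.mulLeft σ) fun τ : Equiv.Perm (Fin N) => g (z ∘ τ)

theorem measurable_symmetrization {N : ℕ} {g : (Fin N → ℂ) → ℝ≥0∞} (hg : Measurable g) :
    Measurable (symmetrization g) := by
  unfold symmetrization
  refine Measurable.const_mul (Finset.measurable_sum _ fun σ _ => ?_) _
  exact hg.comp (measurePreserving_comp_perm (E := ℂ) σ).measurable

theorem inv_factorial_mul_sum_perm_const (N : ℕ) (a : ℝ≥0∞) :
    (N ! : ℝ≥0∞)⁻¹ * ∑ _σ : Equiv.Perm (Fin N), a = a := by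
  rw [Finset.sum_const, Finset.card_univ, Fintype.card_perm, Fintype.card_fin, nsmul_eq_mul,
    ← mul_assoc, ENNReal.inv_mul_cancel, one_mul]
  · exact_mod_cast Nat.factorial_ne_zero N
  · exact ENNReal.natCast_ne_top _

theorem lintegral_ginibreDensity_mul_symmetrization {N : ℕ} {g : (Fin N → ℂ) → ℝ≥0∞}
    (hg : Measurable g) :
    ∫⁻ z, ENNReal.ofReal (ginibreDensity N z) * symmetrization g z
      = ∫⁻ z, ENNReal.ofReal (ginibreDensity N z) * g z := by
  have hm : Measurable fun z => ENNReal.ofReal (ginibreDensity N z) * g z :=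
    (measurable_ginibreDensity N).ennreal_ofReal.mul hg
  have hσ : ∀ σ : Equiv.Perm (Fin N),
      ∫⁻ z, ENNReal.ofReal (ginibreDensity N z) * g (z ∘ σ)
        = ∫⁻ z, ENNReal.ofReal (ginibreDensity N z) * g z := by
    intro σ
    rw [← (measurePreserving_comp_perm (E := ℂ) σ).lintegral_comp hm]
    simp_rw [ginibreDensity_comp_perm]
  have hmσ : ∀ σ : Equiv.Perm (Fin N),
      Measurable fun z => ENNReal.ofReal (ginibreDensity N z) * g (z ∘ σ) := fun σ =>
    (measurable_ginibreDensity N).ennreal_ofReal.mul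
      (hg.comp (measurePreserving_comp_perm (E := ℂ) σ).measurable)
  have hE : ∀ z, ENNReal.ofReal (ginibreDensity N z) * symmetrization g z
      = (N ! : ℝ≥0∞)⁻¹ * ∑ σ : Equiv.Perm (Fin N),
        ENNReal.ofReal (ginibreDensity N z) * g (z ∘ σ) := by
    intro z
    unfold symmetrization
    rw [← Finset.mul_sum]
    ring
  simp_rw [hE]
  rw [lintegral_const_mul _ (Finset.measurable_sum _ fun σ _ => hmσ σ),
    lintegral_finsetSum _ fun σ _ => hmσ σ]
  simp_rw [hσ]
  exact inv_factorial_mul_sum_perm_const N _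

theorem uniformlyOrderedEigenvalues_apply {N : ℕ} (A : Matrix (Fin N) (Fin N) ℂ)
    {s : Set (Fin N → ℂ)} (hs : MeasurableSet s) :
    uniformlyOrderedEigenvalues A s
      = symmetrization (s.indicator 1) (someEigenvalueList A) := by
  unfold uniformlyOrderedEigenvalues symmetrization
  rw [Measure.smul_apply, Measure.finsetSum_apply, smul_eq_mul]
  simp_rw [Measure.dirac_apply' _ hs]

theorem IsComplexGinibre.measurable_rows {Ω : Type*} [MeasurableSpace Ω] {P : Measure Ω} {N : ℕ}
    {M : Ω → Matrix (Fin N) (Fin N) ℂ} (hM : IsComplexGinibre P M) :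
    Measurable (β := Fin N → Fin N → ℂ) M :=
  measurable_pi_lambda _ fun i => measurable_pi_lambda _ fun j => hM.measurable_entry i j

theorem IsComplexGinibre.measurable_symmetric {Ω β : Type*} [MeasurableSpace Ω]
    [MeasurableSpace β] {P : Measure Ω} {N : ℕ} {M : Ω → Matrix (Fin N) (Fin N) ℂ}
    (hM : IsComplexGinibre P M) {f : (Fin N → ℂ) → β} (hf : Measurable f)
    (hs : ∀ z (σ : Equiv.Perm (Fin N)), f (z ∘ σ) = f z) :
    Measurable fun ω => f (someEigenvalueList (M ω)) :=
  ((measurable_symmetric_eigenvalues' hf hs).comp hM.measurable_rows :)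

theorem IsComplexGinibre.measurable_uniformlyOrderedEigenvalues {Ω : Type*} [MeasurableSpace Ω]
    {P : Measure Ω} {N : ℕ} {M : Ω → Matrix (Fin N) (Fin N) ℂ} (hM : IsComplexGinibre P M) :
    Measurable fun ω => uniformlyOrderedEigenvalues (M ω) := by
  refine Measure.measurable_of_measurable_coe _ fun s hs => ?_
  simp_rw [uniformlyOrderedEigenvalues_apply _ hs]
  exact hM.measurable_symmetric (measurable_symmetrization (measurable_one.indicator hs))
    (symmetrization_comp_perm _)

theorem IsComplexGinibre.lintegral_symmetrization_indicator {Ω : Type*} [MeasurableSpace Ω]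
    {P : Measure Ω} [IsProbabilityMeasure P] {N : ℕ} {M : Ω → Matrix (Fin N) (Fin N) ℂ}
    (hM : IsComplexGinibre P M) {s : Set (Fin N → ℂ)} (hs : MeasurableSet s) :
    ∫⁻ ω, symmetrization (s.indicator 1) (someEigenvalueList (M ω)) ∂P
      = volume.withDensity (fun z => ENNReal.ofReal (ginibreDensity N z)) s := by
  have hg : Measurable (s.indicator (1 : (Fin N → ℂ) → ℝ≥0∞)) := measurable_one.indicator hs
  rw [hM.lintegral_symmetric (measurable_symmetrization hg) (symmetrization_comp_perm _),
    lintegral_ginibreDensity_mul_symmetrization hg, withDensity_apply _ hs,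
    ← lintegral_indicator hs]
  refine lintegral_congr fun z => ?_
  classical
  simp [Set.indicator_apply]

theorem IsComplexGinibre.spectrumLaw_eq {Ω : Type*} [MeasurableSpace Ω] {P : Measure Ω}
    [IsProbabilityMeasure P] {N : ℕ} {M : Ω → Matrix (Fin N) (Fin N) ℂ}
    (hM : IsComplexGinibre P M) :
    spectrumLaw P M = volume.withDensity (fun z => ENNReal.ofReal (ginibreDensity N z)) := by
  ext s hs
  unfold spectrumLaw
  rw [Measure.bind_apply hs hM.measurable_uniformlyOrderedEigenvalues.aemeasurable]
  simp_rw [uniformlyOrderedEigenvalues_apply _ hs]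
  exact hM.lintegral_symmetrization_indicator hs

/-- Exchangeability allows an indicator to be replaced by its average over permutations, and this
average depends only on the multiset of eigenvalues. -/
theorem IsComplexGinibre.map_eq_of_isExchangeable {Ω : Type*} [MeasurableSpace Ω] {P : Measure Ω}
    [IsProbabilityMeasure P] {N : ℕ} {M : Ω → Matrix (Fin N) (Fin N) ℂ}
    (hM : IsComplexGinibre P M) {Λ : Ω → Fin N → ℂ} (hΛ : IsExchangeableEigenvalueVector P M Λ) :
    P.map Λ = volume.withDensity (fun z => ENNReal.ofReal (ginibreDensity N z)) := by
  ext s hs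
  have hg : Measurable (s.indicator (1 : (Fin N → ℂ) → ℝ≥0∞)) := measurable_one.indicator hs
  have hσm : ∀ σ : Equiv.Perm (Fin N), Measurable fun z : Fin N → ℂ => z ∘ σ := fun σ =>
    (measurePreserving_comp_perm (E := ℂ) σ).measurable
  have hσ : ∀ σ : Equiv.Perm (Fin N), ∫⁻ ω, s.indicator 1 (Λ ω ∘ σ) ∂P = P.map Λ s := by
    intro σ
    rw [← hΛ.exchangeable σ, ← lintegral_indicator_one hs]
    exact (lintegral_map' hg.aemeasurable
      ((hσm σ).comp_aemeasurable hΛ.aemeasurable)).symm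
  rw [← hM.lintegral_symmetrization_indicator hs]
  have h1 : ∫⁻ ω, symmetrization (s.indicator 1) (someEigenvalueList (M ω)) ∂P
      = ∫⁻ ω, symmetrization (s.indicator 1) (Λ ω) ∂P := by
    apply lintegral_congr_ae
    filter_upwards [hΛ.eigenvalues] with ω hω
    obtain ⟨σ, hσ⟩ := (someEigenvalueList_spec (M ω)).exists_perm hω
    rw [hσ, symmetrization_comp_perm]
  rw [h1]
  unfold symmetrization
  rw [lintegral_const_mul' _ _ (by simp [Nat.factorial_ne_zero]),
    lintegral_finsetSum' (f := fun (σ : Equiv.Perm (Fin N)) ω => s.indicator 1 (Λ ω ∘ σ)) _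
      fun σ _ => (hg.comp (hσm σ)).comp_aemeasurable hΛ.aemeasurable]
  simp_rw [hσ]
  exact (inv_factorial_mul_sum_perm_const N _).symm

theorem joinPoints_castLE {N k : ℕ} (h : k ≤ N) (z : Fin k → ℂ) (w : Fin (N - k) → ℂ)
    (i : Fin k) : joinPoints h z w (Fin.castLE h i) = z i :=
  Fin.append_left z w i

theorem map_castLE_withDensity_ginibreDensity {N k : ℕ} (h : k ≤ N) :
    (volume.withDensity fun z => ENNReal.ofReal (ginibreDensity N z)).map
        (fun z (i : Fin k) => z (Fin.castLE h i))
      = volume.withDensity fun z => ENNReal.ofReal (ginibreMarginal h z) := by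
  have hp : Measurable fun (z : Fin N → ℂ) (i : Fin k) => z (Fin.castLE h i) :=
    measurable_pi_lambda _ fun i => measurable_pi_apply _
  ext s hs
  rw [Measure.map_apply hp hs, withDensity_apply _ (hp hs), withDensity_apply _ hs,
    ← lintegral_indicator (hp hs), ← lintegral_indicator hs, lintegral_joinPoints h
      ((measurable_ginibreDensity N).ennreal_ofReal.indicator (hp hs))]
  refine lintegral_congr fun z => ?_
  have hE : ∀ w, (fun i => joinPoints h z w (Fin.castLE h i)) = z := fun w =>
    funext fun i => joinPoints_castLE h z w i
  classical
  simp only [Set.indicator_apply, Set.mem_preimage, hE]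
  by_cases hz : z ∈ s
  · simp only [hz, if_true]
    rw [lintegral_ginibreDensity_joinPoints, ginibreMarginal_eq]
  · simp [hz]


/-! ### The point process of the eigenvalues -/

/-- The number of distinct coordinates of `z` in `B`. -/
noncomputable def distinctCount {N : ℕ} (B : Set ℂ) (z : Fin N → ℂ) : ℕ :=
  (Set.range z ∩ B).ncard

theorem distinctCount_comp_perm {N : ℕ} (B : Set ℂ) (z : Fin N → ℂ) (σ : Equiv.Perm (Fin N)) :
    distinctCount B (z ∘ σ) = distinctCount B z := by
  unfold distinctCount
  rw [σ.surjective.range_comp]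

-- Each value is counted at its first index. The formula allows repetitions and makes measurability
-- visible.
open Classical in
theorem distinctCount_eq_sum {N : ℕ} (B : Set ℂ) (z : Fin N → ℂ) :
    distinctCount B z = ∑ j, if z j ∈ B ∧ ∀ i < j, z i ≠ z j then 1 else 0 := by
  have h1 : Set.range z ∩ B = z '' {j | z j ∈ B ∧ ∀ i < j, z i ≠ z j} := by
    ext x
    constructor
    · rintro ⟨⟨j, rfl⟩, hj⟩
      obtain ⟨i, hi, hmin⟩ := Finset.exists_min_image (Finset.univ.filter fun i => z i = z j) id
        ⟨j, by simp⟩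
      have hij : z i = z j := (Finset.mem_filter.mp hi).2
      refine ⟨i, ⟨by rwa [hij], fun l hl h => ?_⟩, hij⟩
      have := hmin l (by simp [h, hij])
      exact absurd hl (not_lt.mpr this)
    · rintro ⟨j, ⟨hj, -⟩, rfl⟩
      exact ⟨⟨j, rfl⟩, hj⟩
  have h2 : Set.InjOn z {j | z j ∈ B ∧ ∀ i < j, z i ≠ z j} := by
    intro i hi j hj hij
    rcases lt_trichotomy i j with h | h | h
    · exact absurd hij (hj.2 i h)
    · exact h
    · exact absurd hij.symm (hi.2 j h)
  unfold distinctCount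
  rw [h1, h2.ncard_image, Finset.sum_boole, Nat.cast_id, ← Set.ncard_coe_finset]
  simp

open Classical in
theorem distinctCount_eq_sum_of_injective {N : ℕ} (B : Set ℂ) {z : Fin N → ℂ}
    (hz : Function.Injective z) : distinctCount B z = ∑ j, if z j ∈ B then 1 else 0 := by
  rw [distinctCount_eq_sum]
  refine Finset.sum_congr rfl fun j _ => ?_
  have : ∀ i < j, z i ≠ z j := fun i hi h => hi.ne (hz h)
  exact if_congr (and_iff_left this) rfl rfl

theorem measurable_distinctCount {N : ℕ} {B : Set ℂ} (hB : MeasurableSet B) :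
    Measurable (distinctCount B : (Fin N → ℂ) → ℕ) := by
  classical
  have : (distinctCount B : (Fin N → ℂ) → ℕ)
      = fun z => ∑ j, if z j ∈ B ∧ ∀ i < j, z i ≠ z j then 1 else 0 :=
    funext fun z => distinctCount_eq_sum B z
  rw [this]
  refine Finset.measurable_sum _ fun j _ => Measurable.ite ?_ measurable_const measurable_const
  have h1 : MeasurableSet {z : Fin N → ℂ | z j ∈ B} := measurable_pi_apply j hB
  have h2 : MeasurableSet {z : Fin N → ℂ | ∀ i < j, z i ≠ z j} := by
    simp only [Set.ofPred_forall]
    refine MeasurableSet.iInter fun i => MeasurableSet.iInter fun _ => ?_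
    exact (measurableSet_eq_fun (measurable_pi_apply i) (measurable_pi_apply j)).compl
  exact h1.inter h2

theorem count_eigenvalueSet {N : ℕ} (A : Matrix (Fin N) (Fin N) ℂ) (B : Set ℂ) :
    (eigenvalueSet A).count B = distinctCount B (someEigenvalueList A) := by
  unfold LocallyFiniteSubset.count distinctCount eigenvalueSet
  congr 2
  ext z
  rw [mem_spectrum_iff_of_isEigenvalueList (someEigenvalueList_spec A)]
  rfl

theorem IsComplexGinibre.measurable_eigenvalueSet {Ω : Type*} [MeasurableSpace Ω]
    {P : Measure Ω} {N : ℕ} {M : Ω → Matrix (Fin N) (Fin N) ℂ} (hM : IsComplexGinibre P M) :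
    Measurable fun ω => eigenvalueSet (M ω) := by
  rw [measurable_iff_comap_le]
  refine (MeasurableSpace.comap_iSup.le).trans (iSup_le fun A => ?_)
  rw [MeasurableSpace.comap_comp, ← measurable_iff_comap_le]
  have h := hM.measurable_symmetric (measurable_distinctCount A.2.measurableSet)
    (distinctCount_comp_perm A.1)
  have hE : (LocallyFiniteSubset.count A.1 ∘ fun ω => eigenvalueSet (M ω))
      = fun ω => distinctCount A.1 (someEigenvalueList (M ω)) :=
    funext fun ω => count_eigenvalueSet (M ω) A.1
  rw [hE]
  exact h

/-- The integral of a product of functions of distinct coordinates against the density. -/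
theorem lintegral_ginibreDensity_mul_prod {N k : ℕ} (h : k ≤ N) {B : Fin k → Set ℂ}
    (hB : ∀ i, MeasurableSet (B i)) {g : Fin k → Fin N} (hg : Function.Injective g) :
    ∫⁻ z, ENNReal.ofReal (ginibreDensity N z) * ∏ i, (B i).indicator 1 (z (g i))
      = ENNReal.ofReal ((N - k)! / N !)
        * ∫⁻ z in Set.univ.pi B, ENNReal.ofReal (kernelDetReal N z) := by
  have hprod : ∀ e : Fin k → Fin N,
      Measurable fun z : Fin N → ℂ => ∏ i, (B i).indicator (1 : ℂ → ℝ≥0∞) (z (e i)) := fun e =>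
    Finset.measurable_prod _ fun i _ =>
      (measurable_one.indicator (hB i)).comp (measurable_pi_apply (e i))
  have hm : ∀ e : Fin k → Fin N, Measurable fun z : Fin N → ℂ =>
      ENNReal.ofReal (ginibreDensity N z) * ∏ i, (B i).indicator (1 : ℂ → ℝ≥0∞) (z (e i)) :=
    fun e => (measurable_ginibreDensity N).ennreal_ofReal.mul (hprod e)
  -- A permutation carrying the first `k` indices to the `g i` reduces to the first `k` coordinates,
  -- by symmetry of the density.
  obtain ⟨σ, hσ⟩ := Equiv.Perm.exists_extending_pair (Fin.castLE h) g
    (Fin.castLE_injective h) hg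
  have h1 : ∫⁻ z, ENNReal.ofReal (ginibreDensity N z) * ∏ i, (B i).indicator 1 (z (g i))
      = ∫⁻ z, ENNReal.ofReal (ginibreDensity N z)
        * ∏ i, (B i).indicator 1 (z (Fin.castLE h i)) := by
    rw [← (measurePreserving_comp_perm (E := ℂ) σ).lintegral_comp (hm (Fin.castLE h))]
    simp_rw [ginibreDensity_comp_perm, Function.comp_apply, hσ]
  have hpi : MeasurableSet (Set.univ.pi B) := MeasurableSet.univ_pi hB
  rw [h1, lintegral_joinPoints h (hm (Fin.castLE h)),
    ← lintegral_indicator hpi, ← lintegral_const_mul' _ _ ENNReal.ofReal_ne_top]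
  refine lintegral_congr fun z => ?_
  simp_rw [joinPoints_castLE]
  have hfin : ∏ i, (B i).indicator (1 : ℂ → ℝ≥0∞) (z i) ≠ ∞ := by
    refine ENNReal.prod_ne_top fun i _ => ?_
    by_cases hi : z i ∈ B i <;> simp [hi]
  rw [lintegral_mul_const' _ _ hfin, lintegral_ginibreDensity_joinPoints,
    ENNReal.ofReal_mul (by positivity), mul_assoc]
  congr 1
  by_cases hz : z ∈ Set.univ.pi B
  · rw [Set.indicator_of_mem hz, Finset.prod_eq_one, mul_one]
    intro i _
    exact Set.indicator_of_mem (hz i trivial) 1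
  · rw [Set.indicator_of_notMem hz]
    simp only [Set.mem_pi, Set.mem_univ, true_implies, not_forall] at hz
    obtain ⟨i, hi⟩ := hz
    rw [Finset.prod_eq_zero (Finset.mem_univ i) (Set.indicator_of_notMem hi 1), mul_zero]

theorem IsComplexGinibre.lintegral_prod_count {Ω : Type*} [MeasurableSpace Ω] {P : Measure Ω}
    [IsProbabilityMeasure P] {N : ℕ} {M : Ω → Matrix (Fin N) (Fin N) ℂ}
    (hM : IsComplexGinibre P M) {k : ℕ} {B : Fin k → Set ℂ} (hB : ∀ i, MeasurableSet (B i))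
    (hd : Pairwise fun i j => Disjoint (B i) (B j)) :
    ∫⁻ ω, ∏ i, ((eigenvalueSet (M ω)).count (B i) : ℝ≥0∞) ∂P
      = ∫⁻ z in Set.univ.pi B, ENNReal.ofReal (kernelDetReal N z) := by
  classical
  have hF : Measurable fun z : Fin N → ℂ => ∏ i, (distinctCount (B i) z : ℝ≥0∞) :=
    Finset.measurable_prod _ fun i _ =>
      (measurable_of_countable fun n : ℕ => (n : ℝ≥0∞)).comp (measurable_distinctCount (hB i))
  simp_rw [count_eigenvalueSet]
  rw [hM.lintegral_symmetric hF fun z σ => by simp_rw [distinctCount_comp_perm]]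
  have hE : ∀ᵐ z : Fin N → ℂ, ENNReal.ofReal (ginibreDensity N z)
        * ∏ i, (distinctCount (B i) z : ℝ≥0∞)
      = ∑ g : Fin k → Fin N,
        ENNReal.ofReal (ginibreDensity N z) * ∏ i, (B i).indicator 1 (z (g i)) := by
    filter_upwards [ae_injective N] with z hz
    rw [← Finset.mul_sum]
    congr 1
    rw [← Fintype.piFinset_univ, ← Finset.prod_univ_sum (fun _ : Fin k => Finset.univ)
      fun i j => (B i).indicator (1 : ℂ → ℝ≥0∞) (z j)]
    refine Finset.prod_congr rfl fun i _ => ?_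
    rw [distinctCount_eq_sum_of_injective (B i) hz]
    simp [Set.indicator_apply]
  have hm : ∀ g : Fin k → Fin N, Measurable fun z : Fin N → ℂ =>
      ENNReal.ofReal (ginibreDensity N z)
        * ∏ i, (B i).indicator (1 : ℂ → ℝ≥0∞) (z (g i)) := fun g =>
    (measurable_ginibreDensity N).ennreal_ofReal.mul (Finset.measurable_prod _ fun i _ =>
      (measurable_one.indicator (hB i)).comp (measurable_pi_apply (g i)))
  rw [lintegral_congr_ae hE, lintegral_finsetSum _ fun g _ => hm g]
  -- One coordinate cannot lie in two disjoint sets.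
  have hnon : ∀ g : Fin k → Fin N, ¬ Function.Injective g →
      ∫⁻ z, ENNReal.ofReal (ginibreDensity N z) * ∏ i, (B i).indicator 1 (z (g i)) = 0 := by
    intro g hg
    rw [← lintegral_zero]
    refine lintegral_congr fun z => ?_
    unfold Function.Injective at hg
    push Not at hg
    obtain ⟨i, j, hij, hne⟩ := hg
    by_cases hi : z (g i) ∈ B i
    · have hj : z (g j) ∉ B j := fun hj =>
        Set.disjoint_left.mp (hd hne) hi (hij ▸ hj)
      rw [Finset.prod_eq_zero (Finset.mem_univ j) (Set.indicator_of_notMem hj 1), mul_zero]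
    · rw [Finset.prod_eq_zero (Finset.mem_univ i) (Set.indicator_of_notMem hi 1), mul_zero]
  by_cases h : k ≤ N
  · have hterm : ∀ g : Fin k → Fin N,
        ∫⁻ z, ENNReal.ofReal (ginibreDensity N z) * ∏ i, (B i).indicator 1 (z (g i))
        = if Function.Injective g then ENNReal.ofReal ((N - k)! / N !)
          * ∫⁻ z in Set.univ.pi B, ENNReal.ofReal (kernelDetReal N z) else 0 := by
      intro g
      split_ifs with hg
      · exact lintegral_ginibreDensity_mul_prod h hB hg
      · exact hnon g hg
    -- The number of injections cancels the normalization of the marginal.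
    have hone : (N.descFactorial k : ℝ) * ((N - k)! / N !) = 1 := by
      rw [mul_div_assoc', div_eq_one_iff_eq (by positivity), mul_comm]
      exact_mod_cast Nat.factorial_mul_descFactorial h
    simp_rw [hterm]
    rw [← Finset.sum_filter, Finset.sum_const, ← Fintype.card_subtype,
      Fintype.card_congr (Equiv.subtypeInjectiveEquivEmbedding (Fin k) (Fin N)),
      Fintype.card_embedding_eq, Fintype.card_fin, Fintype.card_fin, nsmul_eq_mul, ← mul_assoc,
      ← ENNReal.ofReal_natCast, ← ENNReal.ofReal_mul (by positivity), hone,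
      ENNReal.ofReal_one, one_mul]
  · have hN : N < k := not_le.mp h
    have hinj : ∀ g : Fin k → Fin N, ¬ Function.Injective g := fun g hg => by
      have := Fintype.card_le_of_injective g hg
      simp at this
      omega
    simp [hnon _ (hinj _), kernelDetReal_eq_zero hN]

theorem IsComplexGinibre.hasCorrelationFunctions {Ω : Type*} [MeasurableSpace Ω] {P : Measure Ω}
    [IsProbabilityMeasure P] {N : ℕ} {M : Ω → Matrix (Fin N) (Fin N) ℂ}
    (hM : IsComplexGinibre P M) :
    HasCorrelationFunctions P (fun ω => eigenvalueSet (M ω))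
      fun k (z : Fin k → ℂ) => (kernelDetReal N z).toNNReal :=
  fun k _ => ⟨(continuous_kernelDetReal N k).measurable.real_toNNReal.aemeasurable,
    fun _ hB hd => hM.lintegral_prod_count (fun i => (hB i).measurableSet) hd⟩

theorem IsComplexGinibre.isDeterminantal {Ω : Type*} [MeasurableSpace Ω] {P : Measure Ω}
    [IsProbabilityMeasure P] {N : ℕ} {M : Ω → Matrix (Fin N) (Fin N) ℂ}
    (hM : IsComplexGinibre P M) :
    IsDeterminantalPointProcess P (fun ω => eigenvalueSet (M ω)) (ginibreKernel N) := by
  refine ⟨hM.measurable_eigenvalueSet, _, hM.hasCorrelationFunctions, fun k _ => ?_⟩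
  refine Filter.Eventually.of_forall fun z => ?_
  rw [Real.coe_toNNReal _ (kernelDetReal_nonneg N z), ofReal_kernelDetReal]

/-! ### Uniqueness of correlation functions -/

/-- Two densities with the same integrals over the sub-boxes of a compact box agree almost
everywhere in that box. -/
theorem ae_restrict_eq_of_lintegral_box_eq {k : ℕ} {f g : (Fin k → ℂ) → ℝ≥0∞}
    (hf : AEMeasurable f) (hg : AEMeasurable g) {R : Fin k → Set ℂ} (hR : ∀ i, IsCompact (R i))
    (hfin : ∫⁻ z in Set.univ.pi R, g z ≠ ∞)
    (h : ∀ B : Fin k → Set ℂ, (∀ i, IsCompact (B i)) → (∀ i, B i ⊆ R i) →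
      ∫⁻ z in Set.univ.pi B, f z = ∫⁻ z in Set.univ.pi B, g z) :
    f =ᵐ[volume.restrict (Set.univ.pi R)] g := by
  have hfR : ∫⁻ z in Set.univ.pi R, f z ≠ ∞ := by
    rwa [h R hR fun i => subset_rfl]
  rw [← withDensity_eq_iff hf.restrict hg.restrict hfR]
  have : IsFiniteMeasure ((volume.restrict (Set.univ.pi R)).withDensity f) :=
    isFiniteMeasure_withDensity hfR
  have hC : ∀ C : Fin k → Set ℂ, (∀ i, IsClosed (C i)) → ∀ u : (Fin k → ℂ) → ℝ≥0∞,
      (volume.restrict (Set.univ.pi R)).withDensity u (Set.univ.pi C)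
        = ∫⁻ z in Set.univ.pi fun i => C i ∩ R i, u z := by
    intro C hC u
    have hm : MeasurableSet (Set.univ.pi C) :=
      MeasurableSet.univ_pi fun i => (hC i).measurableSet
    rw [withDensity_apply _ hm, Measure.restrict_restrict hm, Set.pi_inter_distrib]
  -- Boxes with closed sides form a generating π-system, and intersecting them with `R` makes the
  -- sides compact.
  refine ext_of_generate_finite
    (Set.univ.pi '' Set.univ.pi fun _ : Fin k => {C : Set ℂ | IsClosed C}) ?_
    (IsPiSystem.pi fun _ => isPiSystem_isClosed) ?_ ?_
  · refine (generateFrom_eq_pi (fun _ => ?_) fun _ => ?_).symm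
    · exact borel_eq_generateFrom_isClosed.symm.trans (BorelSpace.measurable_eq (α := ℂ)).symm
    · exact ⟨fun _ => Set.univ, fun _ => isClosed_univ, Set.iUnion_const _⟩
  · rintro _ ⟨C, hCc, rfl⟩
    have hCc' : ∀ i, IsClosed (C i) := fun i => hCc i trivial
    rw [hC C hCc', hC C hCc']
    exact h _ (fun i => (hR i).inter_left (hCc' i)) fun i => Set.inter_subset_right
  · have h1 := hC (fun _ => Set.univ) (fun _ => isClosed_univ)
    rw [Set.pi_univ] at h1
    rw [h1, h1]
    simpa using h R hR fun i => subset_rfl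

theorem exists_disjoint_closedBall {k : ℕ} {z : Fin k → ℂ} (hz : Function.Injective z) :
    ∃ (q : Fin k → ℕ) (n : ℕ),
      (Pairwise fun i j => Disjoint
        (Metric.closedBall (TopologicalSpace.denseSeq ℂ (q i)) (1 / (n + 1) : ℝ))
        (Metric.closedBall (TopologicalSpace.denseSeq ℂ (q j)) (1 / (n + 1) : ℝ))) ∧
      z ∈ Set.univ.pi fun i =>
        Metric.closedBall (TopologicalSpace.denseSeq ℂ (q i)) (1 / (n + 1) : ℝ) := by
  have hδ : ∃ δ > 0, ∀ i j, i ≠ j → δ ≤ dist (z i) (z j) := by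
    let s : Finset (Fin k × Fin k) := Finset.univ.filter fun p => p.1 ≠ p.2
    rcases s.eq_empty_or_nonempty with hs | hs
    · refine ⟨1, one_pos, fun i j hij => ?_⟩
      have : (i, j) ∈ s := by simp [s, hij]
      rw [hs] at this
      simp at this
    · obtain ⟨p, hp, hmin⟩ := s.exists_min_image (fun p => dist (z p.1) (z p.2)) hs
      refine ⟨dist (z p.1) (z p.2), dist_pos.mpr fun h => ?_, fun i j hij =>
        hmin (i, j) (by simp [s, hij])⟩
      exact (Finset.mem_filter.mp hp).2 (hz h)
  obtain ⟨δ, hδ0, hδ⟩ := hδ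
  -- A radius `r < δ/4` puts the centres at distance more than `δ - 2r > 2r`, so the balls are
  -- disjoint.
  obtain ⟨n, hn⟩ := exists_nat_one_div_lt (by positivity : 0 < δ / 4)
  have hr : (0 : ℝ) < 1 / (n + 1) := by positivity
  have hq : ∀ i, ∃ q, dist (z i) (TopologicalSpace.denseSeq ℂ q) < 1 / (n + 1) :=
    fun i => (TopologicalSpace.denseRange_denseSeq ℂ).exists_dist_lt (z i) hr
  choose q hq using hq
  refine ⟨q, n, fun i j hij => ?_, fun i _ => (hq i).le⟩
  refine Metric.closedBall_disjoint_closedBall ?_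
  have h1 := hδ i j hij
  have h2 := dist_triangle4 (z i) (TopologicalSpace.denseSeq ℂ (q i))
    (TopologicalSpace.denseSeq ℂ (q j)) (z j)
  have h3 := hq i
  have h4 := hq j
  rw [dist_comm] at h4
  linarith

/-- Correlation functions are tested only on products of disjoint sets. Countably many products of
disjoint balls cover all vectors with distinct coordinates, and the remaining vectors form a null
set. -/
theorem IsComplexGinibre.ae_eq_of_hasCorrelationFunctions {Ω : Type*} [MeasurableSpace Ω]
    {P : Measure Ω} [IsProbabilityMeasure P] {N : ℕ} {M : Ω → Matrix (Fin N) (Fin N) ℂ}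
    (hM : IsComplexGinibre P M) {ψ : (k : ℕ) → (Fin k → ℂ) → ℝ≥0}
    (hψ : HasCorrelationFunctions P (fun ω => eigenvalueSet (M ω)) ψ) {k : ℕ} (hk : 1 ≤ k) :
    ∀ᵐ z : Fin k → ℂ, (ψ k z : ℝ) = kernelDetReal N z := by
  obtain ⟨hm, hψ⟩ := hψ k hk
  have hD := continuous_kernelDetReal N k
  let R : (Fin k → ℕ) → ℕ → Fin k → Set ℂ := fun q n i =>
    Metric.closedBall (TopologicalSpace.denseSeq ℂ (q i)) (1 / (n + 1) : ℝ)
  have hloc : ∀ q n, (Pairwise fun i j => Disjoint (R q n i) (R q n j)) →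
      ∀ᵐ z : Fin k → ℂ, z ∈ Set.univ.pi (R q n) →
        (ψ k z : ℝ≥0∞) = ENNReal.ofReal (kernelDetReal N z) := by
    intro q n hd
    have hRc : ∀ i, IsCompact (R q n i) := fun i => isCompact_closedBall _ _
    have hpi : IsCompact (Set.univ.pi (R q n)) := isCompact_univ_pi hRc
    rw [← ae_restrict_iff' hpi.measurableSet]
    refine ae_restrict_eq_of_lintegral_box_eq hm.coe_nnreal_ennreal
      hD.measurable.ennreal_ofReal.aemeasurable hRc ?_ fun B hB hBR => ?_
    · have hi : IntegrableOn (fun z : Fin k → ℂ => kernelDetReal N z) (Set.univ.pi (R q n)) :=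
        hD.continuousOn.integrableOn_compact hpi
      exact hi.lintegral_lt_top.ne
    · have hdB : Pairwise fun i j => Disjoint (B i) (B j) := fun i j hij =>
        (hd hij).mono (hBR i) (hBR j)
      rw [← hψ B hB hdB, hM.lintegral_prod_count (fun i => (hB i).measurableSet) hdB]
  have hall : ∀ᵐ z : Fin k → ℂ, ∀ q n, (Pairwise fun i j => Disjoint (R q n i) (R q n j)) →
      z ∈ Set.univ.pi (R q n) → (ψ k z : ℝ≥0∞) = ENNReal.ofReal (kernelDetReal N z) := by
    refine ae_all_iff.mpr fun q => ae_all_iff.mpr fun n => ?_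
    by_cases hd : Pairwise fun i j => Disjoint (R q n i) (R q n j)
    · filter_upwards [hloc q n hd] with z hz _ using hz
    · exact Filter.Eventually.of_forall fun z h => absurd h hd
  filter_upwards [hall, ae_injective k] with z hz hinj
  obtain ⟨q, n, hd, hmem⟩ := exists_disjoint_closedBall hinj
  have h := hz q n hd hmem
  have h' := congrArg ENNReal.toReal h
  rwa [ENNReal.toReal_ofReal (kernelDetReal_nonneg N z), ENNReal.coe_toReal] at h'

theorem kernelDetReal_one (N : ℕ) (z : ℂ) :
    kernelDetReal N (fun _ : Fin 1 => z)
      = ginibreWeight z * ∑ l ∈ Finset.range N, ‖z‖ ^ (2 * l) / (l ! : ℝ) := by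
  have h : kernelDet (ginibreKernel N) (fun _ : Fin 1 => z)
      = ((ginibreWeight z * ∑ l ∈ Finset.range N, ‖z‖ ^ (2 * l) / (l ! : ℝ) : ℝ) : ℂ) := by
    rw [kernelDet, Matrix.det_fin_one, Matrix.of_apply, ginibreKernel,
      Real.sqrt_mul_self (ginibreWeight_pos z).le]
    push_cast
    congr 1
    refine Finset.sum_congr rfl fun l _ => ?_
    rw [Complex.mul_conj, Complex.normSq_eq_norm_sq, pow_mul]
    push_cast
    rfl
  rw [kernelDetReal, h, Complex.ofReal_re]

theorem mainTheorem6 {Ω : Type*} [MeasurableSpace Ω] (P : Measure Ω) [IsProbabilityMeasure P]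
    (N : ℕ) (hN : 1 ≤ N) (M : Ω → Matrix (Fin N) (Fin N) ℂ) (hM : IsComplexGinibre P M) :
    -- the law of the spectrum is well defined, and has density `φ_N`
    (Measurable fun ω => uniformlyOrderedEigenvalues (M ω)) ∧
    spectrumLaw P M = volume.withDensity (fun z => ENNReal.ofReal (ginibreDensity N z)) ∧
    (∀ Λ : Ω → Fin N → ℂ, IsExchangeableEigenvalueVector P M Λ →
      P.map Λ = volume.withDensity (fun z => ENNReal.ofReal (ginibreDensity N z))) ∧
    -- the determinantal form of `φ_N`
    (∀ z : Fin N → ℂ, (ginibreDensity N z : ℂ) = 1 / (N ! : ℂ) * kernelDet (ginibreKernel N) z) ∧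
    -- the eigenvalues form a determinantal point process
    IsDeterminantalPointProcess P (fun ω => eigenvalueSet (M ω)) (ginibreKernel N) ∧
    -- the marginals
    (∀ (k : ℕ) (hk : k ≤ N), 1 ≤ k →
      (∀ z : Fin k → ℂ,
        Integrable (fun w : Fin (N - k) → ℂ => ginibreDensity N (joinPoints hk z w))) ∧
      (spectrumLaw P M).map (fun z (i : Fin k) => z (Fin.castLE hk i)) =
        volume.withDensity (fun z => ENNReal.ofReal (ginibreMarginal hk z)) ∧
      (∀ ψ : (k : ℕ) → (Fin k → ℂ) → ℝ≥0,
        HasCorrelationFunctions P (fun ω => eigenvalueSet (M ω)) ψ →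
        ∀ᵐ z : Fin k → ℂ, ginibreMarginal hk z = ((N - k)! : ℝ) / (N ! : ℝ) * (ψ k z : ℝ)) ∧
      (∀ z : Fin k → ℂ, (ginibreMarginal hk z : ℂ) =
        ((N - k)! : ℂ) / (N ! : ℂ) * kernelDet (ginibreKernel N) z)) ∧
    (∀ z : Fin N → ℂ, ginibreMarginal le_rfl z = ginibreDensity N z) ∧
    (∀ z : ℂ, ginibreMarginal hN (fun _ : Fin 1 => z) =
      ginibreWeight z / (N : ℝ) * ∑ l ∈ Finset.range N, ‖z‖ ^ (2 * l) / (l ! : ℝ)) := by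
  refine ⟨hM.measurable_uniformlyOrderedEigenvalues, hM.spectrumLaw_eq,
    fun Λ hΛ => hM.map_eq_of_isExchangeable hΛ, fun z => ?_, hM.isDeterminantal,
    fun k hk hk1 => ⟨integrable_ginibreDensity_joinPoints hk, ?_, fun ψ hψ => ?_, fun z => ?_⟩,
    fun z => ?_, fun z => ?_⟩
  · rw [ginibreDensity_eq_kernelDetReal, ← ofReal_kernelDetReal]
    push_cast
    ring
  · rw [hM.spectrumLaw_eq, map_castLE_withDensity_ginibreDensity]
  · filter_upwards [hM.ae_eq_of_hasCorrelationFunctions hψ hk1] with z hz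
    rw [ginibreMarginal_eq, hz]
  · rw [ginibreMarginal_eq, ← ofReal_kernelDetReal]
    push_cast
    ring
  · rw [ginibreMarginal_eq, ginibreDensity_eq_kernelDetReal, Nat.sub_self]
    simp
  · rw [ginibreMarginal_eq, kernelDetReal_one]
    obtain ⟨n, rfl⟩ := Nat.exists_eq_add_of_le' hN
    rw [Nat.add_sub_cancel, Nat.factorial_succ]
    have h1 : (n ! : ℝ) ≠ 0 := by positivity
    have h2 : ((n + 1 : ℕ) : ℝ) ≠ 0 := by positivity
    push_cast at h2 ⊢
    field_simp
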